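/- Let $\mathbb B=\{0,1\}$. A Boolean network (BN) of dimension $n$ is a function $f:\mathbb B^n\to\mathbb B^n$. Its functional graph is the digraph with vertex set $\mathbb B^n$ and edge set $\{(x,f(x)) : x\in\mathbb B^n\}$. A sub-hypercube is a vector $h\in\{0,1,\ast\}^n$; its set of vertices is $v(h)=\{x\in\mathbb B^n : \forall i,\ h_i\neq\ast\Rightarrow x_i=h_i\}$. A trap space of $f$ is a sub-hypercube $h$ such that $f(x)\in v(h)$ for every $x\in v(h)$; it is minimal if there is no trap space $h'$ of $f$ with $v(h')\subsetneq v(h)$. Consider the following decision problems, in which the BN $f$ is given by its functional graph, written as the list of its edges (each edge once, in any order, each endpoint written as a word of $n$ bits followed by a separator), and the sub-hypercube $h$ or configuration $x$ is written as a word of length $n$ over $\{0,1,\ast\}$, respectively $\{0,1\}$, followed by a separator and placed before the list of edges: - TRAPSPACE: given a BN $f$ of dimension $n$ and $h\in\{0,1,\ast\}^n$, is $h$ a trap space of $f$? - MINTRAP: given a BN $f$ of dimension $n$ and $h\in\{0,1,\ast\}^n$, is $h$ a minimal trap space of $f$? - IN-MINTRAP: given a BN $f$ of dimension $n$ and $x\in\mathbb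 B^n$, is $x$ a vertex of some minimal trap space of $f$? Theorem. TRAPSPACE, MINTRAP and IN-MINTRAP are in P: the set of encodings of the positive instances of each of the three problems is a language that is decided by a deterministic Turing machine in time polynomial in the length of the input word. -/

import Mathlib

namespace BooleanNetwork

/-- Configurations of dimension `n`: the elements of `𝔹ⁿ`. -/
abbrev Config (n : ℕ) : Type := Fin n → Bool

/-- A Boolean network of dimension `n`. -/
abbrev BN (n : ℕ) : Type := Config n → Config n

/-- A sub-hypercube, as a vector of `{0, 1, ∗}ⁿ`; `none` is the free value `∗`. -/
abbrev SubHypercube (n : ℕ) : Type := Fin n → Option Bool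

/-- The vertices `v(h)` of a sub-hypercube `h`. -/
def vertices {n : ℕ} (h : SubHypercube n) : Set (Config n) :=
  {x | ∀ i, h i ≠ none → some (x i) = h i}

/-- `h` is a trap space of `f`: it is closed by `f`. -/
def IsTrapSpace {n : ℕ} (f : BN n) (h : SubHypercube n) : Prop :=
  ∀ x ∈ vertices h, f x ∈ vertices h

/-- `h` is a minimal trap space of `f`: a trap space that strictly contains no trap space. -/
def IsMinTrapSpace {n : ℕ} (f : BN n) (h : SubHypercube n) : Prop :=
  IsTrapSpace f h ∧ ¬ ∃ h' : SubHypercube n, IsTrapSpace f h' ∧ vertices h' ⊂ vertices h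

/-- `x` is a vertex of a minimal trap space of `f`. -/
def InMinTrapSpace {n : ℕ} (f : BN n) (x : Config n) : Prop :=
  ∃ h : SubHypercube n, IsMinTrapSpace f h ∧ x ∈ vertices h

/-- The functional graph of `f`, with vertex set `𝔹ⁿ` and an edge from `x` to `y` if and only if
`y = f x`. -/
def functionalGraph {n : ℕ} (f : BN n) : Digraph (Config n) where
  Adj x y := y = f x

/-- `es` lists the edges of the digraph `G`, each of them once, in some order. -/
def IsEdgeList {V : Type} (G : Digraph V) (es : List (V × V)) : Prop :=
  es.Nodup ∧ ∀ x y, (x, y) ∈ es ↔ G.Adj x y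

/-- The alphabet in which instances are written: `0`, `1`, `∗` and a separator. -/
inductive Letter : Type
  | bit (b : Bool)
  | star
  | sep

/-- A configuration as a word: its `n` bits, closed by a separator. -/
def encodeConfig {n : ℕ} (x : Config n) : List Letter :=
  List.ofFn (fun i => Letter.bit (x i)) ++ [Letter.sep]

/-- A sub-hypercube as a word: its `n` entries, closed by a separator. -/
def encodeCube {n : ℕ} (h : SubHypercube n) : List Letter :=
  List.ofFn (fun i => (h i).elim Letter.star Letter.bit) ++ [Letter.sep]

/-- A list of edges as a word: the two endpoints of each edge, one edge after the other. -/
def encodeEdges {n : ℕ} (es : List (Config n × Config n)) : List Letter :=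
  es.flatMap fun e => encodeConfig e.1 ++ encodeConfig e.2

/-- TRAPSPACE for Boolean networks given by their functional graph: the language of the encodings
of the pairs `(f, h)` such that `h` is a trap space of `f`. -/
def TRAPSPACE : Language Letter :=
  {w | ∃ (n : ℕ) (f : BN n) (h : SubHypercube n) (es : List (Config n × Config n)),
    IsEdgeList (functionalGraph f) es ∧ w = encodeCube h ++ encodeEdges es ∧ IsTrapSpace f h}

/-- MINTRAP for Boolean networks given by their functional graph: the language of the encodings
of the pairs `(f, h)` such that `h` is a minimal trap space of `f`. -/
def MINTRAP : Language Letter :=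
  {w | ∃ (n : ℕ) (f : BN n) (h : SubHypercube n) (es : List (Config n × Config n)),
    IsEdgeList (functionalGraph f) es ∧ w = encodeCube h ++ encodeEdges es ∧ IsMinTrapSpace f h}

/-- IN-MINTRAP for Boolean networks given by their functional graph: the language of the encodings
of the pairs `(f, x)` such that `x` is a vertex of a minimal trap space of `f`. -/
def INMINTRAP : Language Letter :=
  {w | ∃ (n : ℕ) (f : BN n) (x : Config n) (es : List (Config n × Config n)),
    IsEdgeList (functionalGraph f) es ∧ w = encodeConfig x ++ encodeEdges es ∧ InMinTrapSpace f x}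

open Classical in
/-- The class P: some deterministic Turing machine computes, on every word over the alphabet
(including the words that encode no instance), the membership bit in a number of steps bounded by
a polynomial in the length of the word. -/
def InP {Γ : Type} (L : Language Γ) : Prop :=
  Nonempty (Turing.TM2ComputableInPolyTime (id : List Γ → List Γ) Computability.encodeBool
    (fun w => decide (w ∈ L)))

end BooleanNetwork

/-! Mathematically, everything rests on the smallest trap space containing a sub-hypercube `c`. It
is obtained by enlarging `c`: whenever the source of an edge lies in the current cube, the cube is
replaced by its join with the target. A pass over all edges that changes the cube frees at least one
of the `n` coordinates, so `n` passes reach a fixed point (`addTargets_trapClosure`). A fixed point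
is closed under `f`, and every trap space containing `c` contains all intermediate cubes. Hence `h`
is a trap space iff it contains its closure (`isTrapSpace_iff`); it is a minimal one iff the closure
of each of its vertices is `h` (`isMinTrapSpace_iff`); and `x` lies in a minimal trap space iff the
closure of `x` is minimal (`inMinTrapSpace_iff`). All vertices can be tried in polynomial time
because the input lists all `2 ^ n` edges.

To obtain an actual Turing machine, a small structured language on stacks is compiled to `TM2` code
with preserved step bounds (`Runs.reaches`). Data are binary trees written in preorder, and
`PolyTime` is the class of functions computed by such programs in polynomial time. It is closed
under composition, pairing, case distinction and folds; for folds the accumulator may grow only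
additively (`AddsPoly`), since iterating an arbitrary polynomial-time step may be exponential.
`PolyTime.computable` turns a member of the class into a machine that reads the raw word.

Words that encode no instance must be rejected too. The procedure therefore parses its input and
verifies that the edges form a functional graph: `2 ^ n` edges with distinct sources in `𝔹ⁿ`
(`exists_of_isGraph`). -/

namespace BooleanNetwork

open Turing

/-! ### Structured stack programs and their compilation to machine code. -/

/-- The working stacks of the machine. -/
inductive Reg : Type
  | main
  | aux
  | buf
  | cnt
  deriving DecidableEq

instance : Fintype Reg where
  elems := {.main, .aux, .buf, .cnt}
  complete r := by cases r <;> simp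

/-- The contents of the working stacks. -/
structure Store : Type where
  main : List Letter
  aux : List Letter
  buf : List Letter
  cnt : List Letter

namespace Store

/-- The content of one stack. -/
def get (s : Store) : Reg → List Letter
  | .main => s.main
  | .aux => s.aux
  | .buf => s.buf
  | .cnt => s.cnt

/-- Replace the content of one stack. -/
def set (s : Store) (r : Reg) (l : List Letter) : Store :=
  match r with
  | .main => { s with main := l }
  | .aux => { s with aux := l }
  | .buf => { s with buf := l }
  | .cnt => { s with cnt := l }

end Store

/-- Structured programs acting on the working stacks, with one variable that holds the letter read
last. -/
inductive Prog : Type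
  | push (r : Reg) (g : Option Letter → Letter)
  | pop (r : Reg)
  | peek (r : Reg)
  | seq (p q : Prog)
  | ite (c : Option Letter → Bool) (p q : Prog)
  | loop (c : Option Letter → Bool) (p : Prog)

/-- `Runs p x n y`: the program `p` leads from the state `x` to the state `y` within `n` steps. -/
inductive Runs : Prog → Option Letter × Store → ℕ → Option Letter × Store → Prop
  | push (r g v s) : Runs (.push r g) (v, s) 1 (v, s.set r (g v :: s.get r))
  | pop (r v s) : Runs (.pop r) (v, s) 1 ((s.get r).head?, s.set r (s.get r).tail)
  | peek (r v s) : Runs (.peek r) (v, s) 1 ((s.get r).head?, s)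
  | seq {p q x m y n z} : Runs p x m y → Runs q y n z → Runs (.seq p q) x (m + n) z
  | ite_true {c p q x n y} : c x.1 = true → Runs p x n y → Runs (.ite c p q) x (1 + n) y
  | ite_false {c p q x n y} : c x.1 = false → Runs q x n y → Runs (.ite c p q) x (1 + n) y
  | loop_done {c p x} : c x.1 = false → Runs (.loop c p) x 1 x
  | loop_step {c p x m y n z} : c x.1 = true → Runs p x m y → Runs (.loop c p) y n z →
      Runs (.loop c p) x (1 + m + n) z
  | mono {p x m n y} : Runs p x m y → m ≤ n → Runs p x n y

/-- The alphabets of the stacks of the machine: the stack `none` holds the output. -/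
abbrev Alphabet : Option Reg → Type
  | none => Bool
  | some _ => Letter

/-- The statements of the machine, with labels in `L`. -/
abbrev MStmt (L : Type) : Type := TM2.Stmt Alphabet L (Option Letter)

/-- The stacks of the machine, with an empty output stack. -/
def Store.toStk (s : Store) : ∀ k, List (Alphabet k)
  | none => []
  | some r => s.get r

theorem Store.update_toStk (s : Store) (r : Reg) (l : List Letter) :
    Function.update s.toStk (some r) l = (s.set r l).toStk := by
  funext k
  rcases k with _ | k
  · rfl
  · by_cases h : k = r
    · subst h
      cases k <;> simp [Store.toStk, Store.set, Store.get]
    · rw [Function.update_of_ne (by simpa using h)]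
      cases k <;> cases r <;> first | rfl | exact absurd rfl h

namespace Prog

/-- The labels of the machine code of a program. -/
def Label : Prog → Type
  | push _ _ => Unit
  | pop _ => Unit
  | peek _ => Unit
  | seq p q => p.Label ⊕ q.Label
  | ite _ p q => Option (p.Label ⊕ q.Label)
  | loop _ p => Option p.Label

/-- The label at which the machine code of a program starts. -/
def entry : (p : Prog) → p.Label
  | push _ _ => ()
  | pop _ => ()
  | peek _ => ()
  | seq p _ => Sum.inl p.entry
  | ite _ _ _ => none
  | loop _ _ => none

instance fintypeLabel : (p : Prog) → Fintype p.Label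
  | push _ _ => inferInstanceAs (Fintype Unit)
  | pop _ => inferInstanceAs (Fintype Unit)
  | peek _ => inferInstanceAs (Fintype Unit)
  | seq p q =>
    haveI := fintypeLabel p
    haveI := fintypeLabel q
    inferInstanceAs (Fintype (p.Label ⊕ q.Label))
  | ite _ p q =>
    haveI := fintypeLabel p
    haveI := fintypeLabel q
    inferInstanceAs (Fintype (Option (p.Label ⊕ q.Label)))
  | loop _ p =>
    haveI := fintypeLabel p
    inferInstanceAs (Fintype (Option p.Label))

/-- The machine code of a program: `emb` places its labels among those of the machine, and `exit`
is the label to which it goes in the end. -/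
def code {L : Type} : (p : Prog) → (p.Label → L) → L → p.Label → MStmt L
  | push r g, _, exit => fun _ => .push (some r) g (.goto fun _ => exit)
  | pop r, _, exit => fun _ => .pop (some r) (fun _ a => a) (.goto fun _ => exit)
  | peek r, _, exit => fun _ => .peek (some r) (fun _ a => a) (.goto fun _ => exit)
  | seq p q, emb, exit => fun l => match l with
    | Sum.inl l => p.code (fun l => emb (Sum.inl l)) (emb (Sum.inr q.entry)) l
    | Sum.inr l => q.code (fun l => emb (Sum.inr l)) exit l
  | ite c p q, emb, exit => fun l => match l with
    | none => .branch c (.goto fun _ => emb (some (Sum.inl p.entry)))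
        (.goto fun _ => emb (some (Sum.inr q.entry)))
    | some (Sum.inl l) => p.code (fun l => emb (some (Sum.inl l))) exit l
    | some (Sum.inr l) => q.code (fun l => emb (some (Sum.inr l))) exit l
  | loop c p, emb, exit => fun l => match l with
    | none => .branch c (.goto fun _ => emb (some p.entry)) (.goto fun _ => exit)
    | some l => p.code (fun l => emb (some l)) (emb none) l

end Prog

/-- A configuration of the machine during the run of a program. -/
def progCfg {L : Type} (l : L) (x : Option Letter × Store) :
    TM2.Cfg Alphabet L (Option Letter) :=
  ⟨some l, x.1, x.2.toStk⟩

/-- The machine `M` reaches `d` from `c` within `n` steps. -/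
def ReachesWithin {L : Type} (M : L → MStmt L) (c : TM2.Cfg Alphabet L (Option Letter)) (n : ℕ)
    (d : TM2.Cfg Alphabet L (Option Letter)) : Prop :=
  ∃ k ≤ n, (flip bind (TM2.step M))^[k] (some c) = some d

theorem ReachesWithin.trans {L : Type} {M : L → MStmt L} {c d e} {m n : ℕ}
    (h₁ : ReachesWithin M c m d) (h₂ : ReachesWithin M d n e) : ReachesWithin M c (m + n) e := by
  obtain ⟨j, hj, h₁⟩ := h₁
  obtain ⟨k, hk, h₂⟩ := h₂
  exact ⟨k + j, by omega, by rw [Function.iterate_add_apply, h₁, h₂]⟩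

theorem ReachesWithin.single {L : Type} {M : L → MStmt L} {c d}
    (h : TM2.step M c = some d) : ReachesWithin M c 1 d :=
  ⟨1, le_rfl, h⟩

/-- Induction on the run. The exit label varies because a subprogram is left towards its context:
the first half of a `seq` towards the entry of the second, a loop body back to the loop test. Only
labels in the range of `emb` are constrained, so the code may sit inside a larger machine. -/
theorem Runs.reaches {p : Prog} {x y : Option Letter × Store} {n : ℕ} (h : Runs p x n y)
    {L : Type} (M : L → MStmt L) (emb : p.Label → L) (exit : L)
    (hM : ∀ l, M (emb l) = p.code emb exit l) :
    ReachesWithin M (progCfg (emb p.entry) x) n (progCfg exit y) := by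
  induction h generalizing exit with
  | push r g v s =>
    refine .single ?_
    simp only [progCfg, TM2.step, hM, Prog.code, TM2.stepAux]
    rw [← Store.update_toStk]
    rfl
  | pop r v s =>
    refine .single ?_
    simp only [progCfg, TM2.step, hM, Prog.code, TM2.stepAux]
    rw [← Store.update_toStk]
    rfl
  | peek r v s =>
    refine .single ?_
    simp only [progCfg, TM2.step, hM, Prog.code, TM2.stepAux]
    rfl
  | seq _ _ ih₁ ih₂ =>
    exact (ih₁ _ _ fun l => hM (Sum.inl l)).trans (ih₂ _ _ fun l => hM (Sum.inr l))
  | ite_true hc _ ih =>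
    refine (ReachesWithin.single ?_).trans (ih _ _ fun l => hM (some (Sum.inl l)))
    have h₀ := hM none
    simp only [Prog.code] at h₀
    simp only [progCfg, TM2.step, Prog.entry, h₀, TM2.stepAux, hc, cond_true]
  | ite_false hc _ ih =>
    refine (ReachesWithin.single ?_).trans (ih _ _ fun l => hM (some (Sum.inr l)))
    have h₀ := hM none
    simp only [Prog.code] at h₀
    simp only [progCfg, TM2.step, Prog.entry, h₀, TM2.stepAux, hc, cond_false]
  | loop_done hc =>
    refine ReachesWithin.single ?_
    have h₀ := hM none
    simp only [Prog.code] at h₀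
    simp only [progCfg, TM2.step, Prog.entry, h₀, TM2.stepAux, hc, cond_false]
  | loop_step hc _ _ ih₁ ih₂ =>
    refine ((ReachesWithin.single ?_).trans (ih₁ _ _ fun l => hM (some l))).trans (ih₂ _ _ hM)
    have h₀ := hM none
    simp only [Prog.code] at h₀
    simp only [progCfg, TM2.step, Prog.entry, h₀, TM2.stepAux, hc, cond_true]
  | mono _ hmn ih =>
    obtain ⟨k, hk, h⟩ := ih emb exit hM
    exact ⟨k, hk.trans hmn, h⟩

/-! ### Preorder codes of trees on a stack, and the elementary tree operations. -/

/-- Binary trees, the data on which programs work. -/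
inductive Tree : Type
  | nil
  | node (l r : Tree)

namespace Tree

/-- The preorder code of a tree. -/
def code : Tree → List Letter
  | nil => [.bit false]
  | node l r => .bit true :: (l.code ++ r.code)

/-- The number of nodes of a tree, that is the length of its code. -/
def size : Tree → ℕ
  | nil => 1
  | node l r => l.size + r.size + 1

theorem length_code (t : Tree) : t.code.length = t.size := by
  induction t with
  | nil => rfl
  | node l r hl hr => simp [code, size, hl, hr]

theorem size_pos (t : Tree) : 1 ≤ t.size := by
  cases t <;> simp [size]

end Tree

/-- Was a separator read? -/
def isSep : Option Letter → Bool
  | some .sep => true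
  | _ => false

/-- Was the code of an inner node read? -/
def isNode : Option Letter → Bool
  | some (.bit true) => true
  | _ => false

/-- The letter read last. -/
def lastRead (v : Option Letter) : Letter := v.getD .sep

namespace Prog

/-- Push a fixed letter. -/
def put (r : Reg) (a : Letter) : Prog := push r fun _ => a

/-- Append `q` to `p` if `b` holds. -/
def seqIf (p : Prog) (b : Bool) (q : Prog) : Prog := if b then p.seq q else p

/-- The body of the loop of `Prog.scan`. -/
def scanBody (a b : Bool) : Prog :=
  ((((pop .main).seqIf a (push .aux lastRead)).seqIf b (push .buf lastRead)).seq
    (ite isNode (put .cnt .star) (pop .cnt))).seq (peek .cnt)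

/-- Remove a tree from the main stack, and copy its code to `aux` if `a` holds and to `buf` if `b`
holds. The number of subtrees still to be read is counted on the stack `cnt`. -/
def scan (a b : Bool) : Prog :=
  ((((put .cnt .sep).seq (put .cnt .star)).seq (peek .cnt)).seq
    (loop (fun v => !isSep v) (scanBody a b))).seq (pop .cnt)

/-- Move everything above the first separator of `r`, and this separator, to the main stack, without
the separator. -/
def back (r : Reg) : Prog :=
  (pop r).seq (loop (fun v => !isSep v) ((push .main lastRead).seq (pop r)))

/-- Duplicate the topmost tree. -/
def dup : Prog :=
  ((((put .aux .sep).seq (put .buf .sep)).seq (scan true true)).seq (back .aux)).seq (back .buf)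

/-- Exchange the two topmost trees. -/
def swap : Prog :=
  (((((put .aux .sep).seq (scan true false)).seq (put .buf .sep)).seq (scan false true)).seq
    (back .aux)).seq (back .buf)

/-- Remove the topmost tree. -/
def drop : Prog := scan false false

/-- Replace a node by its left subtree. -/
def left : Prog :=
  ((((pop .main).seq (put .aux .sep)).seq (scan true false)).seq drop).seq (back .aux)

/-- Replace a node by its right subtree. -/
def right : Prog := (pop .main).seq drop

end Prog

/-- The stack `l` after the code of `t` has been copied to it, if `b` holds. -/
def pushCode (b : Bool) (t : Tree) (l : List Letter) : List Letter :=
  if b then t.code.reverse ++ l else l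

theorem pushCode_node (b : Bool) (t u : Tree) (l : List Letter) :
    pushCode b (.node t u) l =
      pushCode b u (pushCode b t (if b then .bit true :: l else l)) := by
  cases b <;> simp [pushCode, Tree.code]

theorem runs_scanBody_node (a b : Bool) (v m x y c) :
    Runs (.scanBody a b) (v, ⟨.bit true :: m, x, y, c⟩) 6
      (some .star, ⟨m, if a then .bit true :: x else x, if b then .bit true :: y else y,
        .star :: c⟩) := by
  cases a <;> cases b
  · exact .mono (.seq (.seq (.pop _ _ _) (.ite_true rfl (.push _ _ _ _))) (.peek _ _ _))
      (by norm_num)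
  · exact .mono (.seq (.seq (.seq (.pop _ _ _) (.push _ _ _ _)) (.ite_true rfl (.push _ _ _ _)))
      (.peek _ _ _)) (by norm_num)
  · exact .mono (.seq (.seq (.seq (.pop _ _ _) (.push _ _ _ _)) (.ite_true rfl (.push _ _ _ _)))
      (.peek _ _ _)) (by norm_num)
  · exact .seq (.seq (.seq (.seq (.pop _ _ _) (.push _ _ _ _)) (.push _ _ _ _))
      (.ite_true rfl (.push _ _ _ _))) (.peek _ _ _)

theorem runs_scanBody_nil (a b : Bool) (v m x y c) :
    Runs (.scanBody a b) (v, ⟨.bit false :: m, x, y, .star :: c⟩) 6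
      (c.head?, ⟨m, pushCode a .nil x, pushCode b .nil y, c⟩) := by
  cases a <;> cases b
  · exact .mono (.seq (.seq (.pop _ _ _) (.ite_false rfl (.pop _ _ _))) (.peek _ _ _))
      (by norm_num)
  · exact .mono (.seq (.seq (.seq (.pop _ _ _) (.push _ _ _ _)) (.ite_false rfl (.pop _ _ _)))
      (.peek _ _ _)) (by norm_num)
  · exact .mono (.seq (.seq (.seq (.pop _ _ _) (.push _ _ _ _)) (.ite_false rfl (.pop _ _ _)))
      (.peek _ _ _)) (by norm_num)
  · exact .seq (.seq (.seq (.seq (.pop _ _ _) (.push _ _ _ _)) (.push _ _ _ _))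
      (.ite_false rfl (.pop _ _ _))) (.peek _ _ _)

/-- Each `.star` on the counter stands for one subtree still to be read: an inner node adds one, a
leaf removes one. The loop need not stop after `t`, so the rest of the run is a hypothesis; this
lets the right subtree serve as the continuation of the left one. Each letter costs one loop test
and at most 6 steps of the body. -/
theorem runs_scan_loop (a b : Bool) (t : Tree) (m x y c : List Letter) (k : ℕ)
    (z : Option Letter × Store)
    (h : Runs (.loop (fun v => !isSep v) (.scanBody a b))
      (c.head?, ⟨m, pushCode a t x, pushCode b t y, c⟩) k z) :
    Runs (.loop (fun v => !isSep v) (.scanBody a b))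
      (some .star, ⟨t.code ++ m, x, y, .star :: c⟩) (k + 7 * t.size) z := by
  induction t generalizing m x y c k z with
  | nil =>
    exact .mono (.loop_step rfl (runs_scanBody_nil a b _ _ _ _ _) h) (by simp [Tree.size]; omega)
  | node l r hl hr =>
    have := hl (r.code ++ m) (if a then .bit true :: x else x) (if b then .bit true :: y else y)
      (.star :: c) (k + 7 * r.size) z
      (hr _ _ _ _ _ _ (by rwa [pushCode_node, pushCode_node] at h))
    rw [← List.append_assoc] at this
    exact .mono (.loop_step rfl (runs_scanBody_node a b _ _ _ _ _) this)
      (by simp only [Tree.size]; omega)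

theorem runs_scan (a b : Bool) (t : Tree) (v m x y c) :
    ∃ v', Runs (.scan a b) (v, ⟨t.code ++ m, x, y, c⟩) (5 + 7 * t.size)
      (v', ⟨m, pushCode a t x, pushCode b t y, c⟩) := by
  refine ⟨_, .mono (.seq (.seq (.seq (.seq (.push _ _ _ _) (.push _ _ _ _)) (.peek _ _ _))
    (runs_scan_loop a b t m x y (.sep :: c) _ _ (.loop_done rfl))) (.pop _ _ _)) ?_⟩
  omega

theorem runs_drop (t : Tree) (v m x y c) :
    ∃ v', Runs .drop (v, ⟨t.code ++ m, x, y, c⟩) (5 + 7 * t.size) (v', ⟨m, x, y, c⟩) :=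
  runs_scan false false t v m x y c

theorem sep_notMem_code (t : Tree) : .sep ∉ t.code := by
  induction t with
  | nil => simp [Tree.code]
  | node l r hl hr => simp [Tree.code, hl, hr]

/-- Moving letters between stacks reverses them, which undoes the reversal made by `scan`. Tree
codes contain no separator, so the first separator is the marker put down before the scan. -/
theorem runs_back_aux (l : List Letter) (hl : .sep ∉ l) (v m x y c) :
    ∃ v', Runs (.back .aux) (v, ⟨m, l ++ .sep :: x, y, c⟩) (2 + 3 * l.length)
      (v', ⟨l.reverse ++ m, x, y, c⟩) := by
  refine ⟨some .sep, ?_⟩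
  suffices h : ∀ m, Runs (.loop (fun v => !isSep v) ((Prog.push .main lastRead).seq (.pop .aux)))
      ((l ++ .sep :: x).head?, ⟨m, (l ++ .sep :: x).tail, y, c⟩) (1 + 3 * l.length)
      (some .sep, ⟨l.reverse ++ m, x, y, c⟩) from
    .mono (.seq (.pop _ _ _) (h m)) (by omega)
  induction l with
  | nil => exact fun m => .loop_done rfl
  | cons a l ih =>
    intro m
    rw [List.mem_cons, not_or] at hl
    have ha : (!isSep (some a)) = true := by cases a <;> simp_all [isSep]
    have := ih hl.2 (a :: m)
    rw [List.reverse_cons, List.append_assoc]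
    exact .mono (.loop_step ha (.seq (.push _ _ _ _) (.pop _ _ _)) this)
      (by simp only [List.length_cons]; omega)

theorem runs_back_buf (l : List Letter) (hl : .sep ∉ l) (v m x y c) :
    ∃ v', Runs (.back .buf) (v, ⟨m, x, l ++ .sep :: y, c⟩) (2 + 3 * l.length)
      (v', ⟨l.reverse ++ m, x, y, c⟩) := by
  refine ⟨some .sep, ?_⟩
  suffices h : ∀ m, Runs (.loop (fun v => !isSep v) ((Prog.push .main lastRead).seq (.pop .buf)))
      ((l ++ .sep :: y).head?, ⟨m, x, (l ++ .sep :: y).tail, c⟩) (1 + 3 * l.length)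
      (some .sep, ⟨l.reverse ++ m, x, y, c⟩) from
    .mono (.seq (.pop _ _ _) (h m)) (by omega)
  induction l with
  | nil => exact fun m => .loop_done rfl
  | cons a l ih =>
    intro m
    rw [List.mem_cons, not_or] at hl
    have ha : (!isSep (some a)) = true := by cases a <;> simp_all [isSep]
    have := ih hl.2 (a :: m)
    rw [List.reverse_cons, List.append_assoc]
    exact .mono (.loop_step ha (.seq (.push _ _ _ _) (.pop _ _ _)) this)
      (by simp only [List.length_cons]; omega)

theorem runs_back_aux_code (t : Tree) (v m x y c) :
    ∃ v', Runs (.back .aux) (v, ⟨m, pushCode true t (.sep :: x), y, c⟩) (2 + 3 * t.size)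
      (v', ⟨t.code ++ m, x, y, c⟩) := by
  simpa [pushCode, Tree.length_code] using
    runs_back_aux t.code.reverse (by simpa using sep_notMem_code t) v m x y c

theorem runs_back_buf_code (t : Tree) (v m x y c) :
    ∃ v', Runs (.back .buf) (v, ⟨m, x, pushCode true t (.sep :: y), c⟩) (2 + 3 * t.size)
      (v', ⟨t.code ++ m, x, y, c⟩) := by
  simpa [pushCode, Tree.length_code] using
    runs_back_buf t.code.reverse (by simpa using sep_notMem_code t) v m x y c

theorem runs_dup (t : Tree) (v m x y c) :
    ∃ v', Runs .dup (v, ⟨t.code ++ m, x, y, c⟩) (11 + 13 * t.size)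
      (v', ⟨t.code ++ (t.code ++ m), x, y, c⟩) := by
  obtain ⟨_, h₁⟩ := runs_scan true true t v m (.sep :: x) (.sep :: y) c
  obtain ⟨_, h₂⟩ := runs_back_aux_code t _ m x _ c
  obtain ⟨_, h₃⟩ := runs_back_buf_code t _ (t.code ++ m) x y c
  exact ⟨_, .mono (.seq (.seq (.seq (.seq (.push _ _ _ _) (.push _ _ _ _)) h₁) h₂) h₃) (by omega)⟩

theorem runs_swap (t u : Tree) (v m x y c) :
    ∃ v', Runs .swap (v, ⟨t.code ++ (u.code ++ m), x, y, c⟩) (16 + 10 * (t.size + u.size))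
      (v', ⟨u.code ++ (t.code ++ m), x, y, c⟩) := by
  obtain ⟨_, h₁⟩ := runs_scan true false t v (u.code ++ m) (.sep :: x) y c
  obtain ⟨_, h₂⟩ := runs_scan false true u _ m (pushCode true t (.sep :: x)) (.sep :: y) c
  obtain ⟨_, h₃⟩ := runs_back_aux_code t _ m x _ c
  obtain ⟨_, h₄⟩ := runs_back_buf_code u _ (t.code ++ m) x y c
  exact ⟨_, .mono (.seq (.seq (.seq (.seq (.seq (.push _ _ _ _) h₁) (.push _ _ _ _)) h₂) h₃) h₄)
    (by omega)⟩

theorem runs_left (t u : Tree) (v m x y c) :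
    ∃ v', Runs .left (v, ⟨(Tree.node t u).code ++ m, x, y, c⟩) (14 + 10 * (t.size + u.size))
      (v', ⟨t.code ++ m, x, y, c⟩) := by
  obtain ⟨_, h₁⟩ := runs_scan true false t (some (.bit true)) (u.code ++ m) (.sep :: x) y c
  obtain ⟨_, h₂⟩ := runs_drop u _ m (pushCode true t (.sep :: x)) y c
  obtain ⟨_, h₃⟩ := runs_back_aux_code t _ m x y c
  rw [← List.append_assoc] at h₁
  exact ⟨_, .mono (.seq (.seq (.seq (.seq (.pop _ _ _) (.push _ _ _ _)) h₁) h₂) h₃) (by omega)⟩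

theorem runs_right (t u : Tree) (v m x y c) :
    ∃ v', Runs .right (v, ⟨(Tree.node t u).code ++ m, x, y, c⟩) (6 + 7 * t.size)
      (v', ⟨u.code ++ m, x, y, c⟩) := by
  obtain ⟨_, h₁⟩ := runs_drop t (some (.bit true)) (u.code ++ m) x y c
  rw [← List.append_assoc] at h₁
  exact ⟨_, .mono (.seq (.pop _ _ _) h₁) (by omega)⟩

/-! ### Polynomial-time transformations of trees. -/

open Polynomial (eval_add eval_mul eval_X eval_ofNat)

theorem eval_le_eval (P : Polynomial ℕ) {m n : ℕ} (h : m ≤ n) : P.eval m ≤ P.eval n := by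
  rw [Polynomial.eval_eq_sum_range, Polynomial.eval_eq_sum_range]
  gcongr

/-- One program turns the tree `e i` into the tree `t i`, for every `i`, in polynomial time. It works
on the top of the stacks and leaves everything below unchanged. -/
def Transforms {ι : Type} (e t : ι → Tree) : Prop :=
  ∃ (p : Prog) (P : Polynomial ℕ), ∀ i, (t i).size ≤ P.eval (e i).size ∧
    ∀ v m x y c, ∃ v', Runs p (v, ⟨(e i).code ++ m, x, y, c⟩) (P.eval (e i).size)
      (v', ⟨(t i).code ++ m, x, y, c⟩)

namespace Transforms

variable {ι κ : Type} {e t u : ι → Tree}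

theorem refl (e : ι → Tree) : Transforms e e :=
  ⟨.peek .main, .X + 1, fun i => ⟨by simp, fun v m x y c =>
    ⟨_, .mono (.peek _ _ _) (by simp)⟩⟩⟩

/-- The output size bound in `Transforms` is needed here: the second program runs on a tree of size
at most `P`, and `Q` is monotone because its coefficients are natural numbers. -/
theorem trans (h₁ : Transforms e t) (h₂ : Transforms t u) : Transforms e u := by
  obtain ⟨p, P, hp⟩ := h₁
  obtain ⟨q, Q, hq⟩ := h₂
  refine ⟨p.seq q, P + Q.comp P, fun i => ?_⟩
  have hQ := eval_le_eval Q (hp i).1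
  refine ⟨(hq i).1.trans (by simp; omega), fun v m x y c => ?_⟩
  obtain ⟨v₁, h₁⟩ := (hp i).2 v m x y c
  obtain ⟨v₂, h₂⟩ := (hq i).2 v₁ m x y c
  exact ⟨v₂, .mono (.seq h₁ h₂) (by simp; omega)⟩

theorem comap (g : κ → ι) (h : Transforms e t) :
    Transforms (fun k => e (g k)) (fun k => t (g k)) := by
  obtain ⟨p, P, hp⟩ := h
  exact ⟨p, P, fun k => hp (g k)⟩

theorem nil (e : ι → Tree) : Transforms e fun _ => .nil := by
  refine ⟨Prog.drop.seq (.put .main (.bit false)), 6 + 7 * .X, fun i => ⟨?_, fun v m x y c => ?_⟩⟩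
  · simp only [Tree.size, eval_add, eval_mul, eval_X, eval_ofNat]; omega
  · obtain ⟨v₁, h₁⟩ := runs_drop (e i) v m x y c
    refine ⟨_, .mono (.seq h₁ (.push _ _ _ _)) ?_⟩
    simp only [eval_add, eval_mul, eval_X, eval_ofNat]; omega

theorem node (h₁ : Transforms e t) (h₂ : Transforms e u) :
    Transforms e fun i => .node (t i) (u i) := by
  obtain ⟨p, P, hp⟩ := h₁
  obtain ⟨q, Q, hq⟩ := h₂
  -- The right subtree is computed first, on one copy of the input; after the swap the left one is
  -- computed on the other copy and ends up on top, as preorder requires.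
  refine ⟨(((Prog.dup.seq q).seq .swap).seq p).seq (.put .main (.bit true)),
    28 + 23 * .X + P + 11 * Q, fun i => ⟨?_, fun v m x y c => ?_⟩⟩
  · have := (hp i).1
    have := (hq i).1
    simp only [Tree.size, eval_add, eval_mul, eval_X, eval_ofNat]; omega
  · obtain ⟨v₁, h₁⟩ := runs_dup (e i) v m x y c
    obtain ⟨v₂, h₂⟩ := (hq i).2 v₁ ((e i).code ++ m) x y c
    obtain ⟨v₃, h₃⟩ := runs_swap (u i) (e i) v₂ m x y c
    obtain ⟨v₄, h₄⟩ := (hp i).2 v₃ ((u i).code ++ m) x y c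
    have := (hq i).1
    rw [Tree.code, List.cons_append, List.append_assoc]
    refine ⟨v₄, .mono (.seq (.seq (.seq (.seq h₁ h₂) h₃) h₄) (.push _ _ _ _)) ?_⟩
    simp only [eval_add, eval_mul, eval_X, eval_ofNat]; omega

theorem left (t u : ι → Tree) : Transforms (fun i => .node (t i) (u i)) t := by
  refine ⟨.left, 14 + 10 * .X, fun i => ⟨?_, fun v m x y c => ?_⟩⟩
  · simp only [Tree.size, eval_add, eval_mul, eval_X, eval_ofNat]; omega
  obtain ⟨v₁, h₁⟩ := runs_left (t i) (u i) v m x y c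
  exact ⟨v₁, .mono h₁ (by simp only [Tree.size, eval_add, eval_mul, eval_X, eval_ofNat]; omega)⟩

theorem right (t u : ι → Tree) : Transforms (fun i => .node (t i) (u i)) u := by
  refine ⟨.right, 6 + 10 * .X, fun i => ⟨?_, fun v m x y c => ?_⟩⟩
  · simp only [Tree.size, eval_add, eval_mul, eval_X, eval_ofNat]; omega
  obtain ⟨v₁, h₁⟩ := runs_right (t i) (u i) v m x y c
  exact ⟨v₁, .mono h₁ (by simp only [Tree.size, eval_add, eval_mul, eval_X, eval_ofNat]; omega)⟩

theorem const (e : ι → Tree) (t : Tree) : Transforms e fun _ => t := by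
  induction t with
  | nil => exact nil e
  | node l r hl hr => exact hl.node hr

/-- Case distinction on a computed tree. -/
theorem cases {d : ι → Tree} (hd : Transforms e d)
    (h₀ : Transforms (fun i : {i // d i = .nil} => e i) fun i => t i)
    (h₁ : Transforms (fun i : {i // d i ≠ .nil} => e i) fun i => t i) : Transforms e t := by
  obtain ⟨r, R, hr⟩ := hd
  obtain ⟨p, P, hp⟩ := h₀
  obtain ⟨q, Q, hq⟩ := h₁
  -- Popping the root letter of the computed tree decides the case. For a leaf this already removes
  -- the whole tree; for a node the letter is put back so that `drop` can remove the tree. Each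
  -- branch program needs to be correct only on its own case.
  refine ⟨((Prog.dup.seq r).seq (.pop .main)).seq
    (.ite isNode (((Prog.put .main (.bit true)).seq .drop).seq q) p),
    20 + 13 * .X + 8 * R + P + Q, fun i => ?_⟩
  by_cases hi : d i = .nil
  · refine ⟨(hp ⟨i, hi⟩).1.trans ?_, fun v m x y c => ?_⟩
    · simp only [eval_add, eval_mul, eval_X, eval_ofNat]; omega
    obtain ⟨v₁, h₁⟩ := runs_dup (e i) v m x y c
    obtain ⟨v₂, h₂⟩ := (hr i).2 v₁ ((e i).code ++ m) x y c
    obtain ⟨v₃, h₃⟩ := (hp ⟨i, hi⟩).2 (some (.bit false)) m x y c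
    rw [hi] at h₂
    refine ⟨v₃, .mono (.seq (.seq (.seq h₁ h₂) (.pop _ _ _)) (.ite_false rfl h₃)) ?_⟩
    simp only [eval_add, eval_mul, eval_X, eval_ofNat]; omega
  · refine ⟨(hq ⟨i, hi⟩).1.trans ?_, fun v m x y c => ?_⟩
    · simp only [eval_add, eval_mul, eval_X, eval_ofNat]; omega
    obtain ⟨v₁, h₁⟩ := runs_dup (e i) v m x y c
    obtain ⟨v₂, h₂⟩ := (hr i).2 v₁ ((e i).code ++ m) x y c
    obtain ⟨v₃, h₃⟩ := runs_drop (d i) (some (.bit true)) ((e i).code ++ m) x y c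
    obtain ⟨v₄, h₄⟩ := (hq ⟨i, hi⟩).2 v₃ m x y c
    have hs := (hr i).1
    refine ⟨v₄, ?_⟩
    cases hd : d i with
    | nil => exact absurd hd hi
    | node a b =>
      rw [hd] at h₂ h₃ hs
      refine .mono (.seq (.seq (.seq h₁ h₂) (.pop _ _ _)) (.ite_true rfl
        (.seq (.seq (.push _ _ _ _) h₃) h₄))) ?_
      simp only [eval_add, eval_mul, eval_X, eval_ofNat]; omega

end Transforms

/-! ### Tree encodings of data types, and closure properties of polynomial time. -/

/-- A representation of the elements of a type by trees. -/
class TreeEncoding (α : Type) where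
  toTree : α → Tree

open TreeEncoding (toTree)

instance : TreeEncoding Unit := ⟨fun _ => .nil⟩

instance : TreeEncoding Bool := ⟨fun b => if b then .node .nil .nil else .nil⟩

instance {α β : Type} [TreeEncoding α] [TreeEncoding β] : TreeEncoding (α × β) :=
  ⟨fun p => .node (toTree p.1) (toTree p.2)⟩

/-- The tree of a list, with the trees of its entries as left subtrees along the right branch. -/
def listToTree {α : Type} [TreeEncoding α] : List α → Tree
  | [] => .nil
  | a :: l => .node (toTree a) (listToTree l)

instance {α : Type} [TreeEncoding α] : TreeEncoding (List α) := ⟨listToTree⟩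

/-- Unary notation suffices, since the only numbers represented are at most the number of edges in
the input. It makes the successor a `cons`. -/
instance : TreeEncoding ℕ := ⟨fun n => toTree (List.replicate n ())⟩

/-- Letters as pairs of truth values. -/
def letterCode : Letter → Bool × Bool
  | .bit b => (true, b)
  | .star => (false, false)
  | .sep => (false, true)

instance : TreeEncoding Letter := ⟨fun a => toTree (letterCode a)⟩

/-- The size of the tree that represents an element. -/
def treeSize {α : Type} [TreeEncoding α] (a : α) : ℕ := (toTree a).size

section Size

variable {α β : Type} [TreeEncoding α] [TreeEncoding β]

@[simp]
theorem treeSize_pair (p : α × β) : treeSize p = treeSize p.1 + treeSize p.2 + 1 := rfl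

@[simp]
theorem treeSize_nil : treeSize ([] : List α) = 1 := rfl

@[simp]
theorem treeSize_cons (a : α) (l : List α) : treeSize (a :: l) = treeSize a + treeSize l + 1 := rfl

theorem treeSize_bool_le (b : Bool) : treeSize b ≤ 3 := by
  cases b <;> decide

theorem treeSize_letter_le (a : Letter) : treeSize a ≤ 7 := by
  rcases a with (_ | _) | _ | _ <;> decide

theorem treeSize_nat (n : ℕ) : treeSize n = 2 * n + 1 := by
  induction n with
  | zero => rfl
  | succ n ih =>
    change 1 + treeSize n + 1 = _
    omega

theorem treeSize_pos (a : α) : 1 ≤ treeSize a := Tree.size_pos _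

theorem length_le_treeSize (l : List α) : l.length ≤ treeSize l := by
  induction l with
  | nil => simp
  | cons a l ih => simp; omega

theorem treeSize_le_of_mem {a : α} {l : List α} (h : a ∈ l) : treeSize a ≤ treeSize l := by
  induction l with
  | nil => simp at h
  | cons b l ih =>
    rcases List.mem_cons.1 h with rfl | h
    · simp; omega
    · have := ih h
      simp; omega

end Size

/-- `f` is computed in polynomial time by a program that works on trees. -/
def PolyTime {α β : Type} [TreeEncoding α] [TreeEncoding β] (f : α → β) : Prop :=
  Transforms toTree fun a => toTree (f a)

namespace PolyTime

variable {α β γ δ : Type} [TreeEncoding α] [TreeEncoding β] [TreeEncoding γ] [TreeEncoding δ]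

theorem id : PolyTime fun a : α => a := Transforms.refl _

theorem comp {g : β → γ} {f : α → β} (hg : PolyTime g) (hf : PolyTime f) :
    PolyTime fun a => g (f a) :=
  Transforms.trans hf (Transforms.comap f hg)

theorem const (b : β) : PolyTime fun _ : α => b := Transforms.const _ _

theorem pair {f : α → β} {g : α → γ} (hf : PolyTime f) (hg : PolyTime g) :
    PolyTime fun a => (f a, g a) :=
  Transforms.node hf hg

theorem fst {f : α → β × γ} (hf : PolyTime f) : PolyTime fun a => (f a).1 :=
  Transforms.trans hf (Transforms.left (fun a => toTree (f a).1) fun a => toTree (f a).2)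

theorem snd {f : α → β × γ} (hf : PolyTime f) : PolyTime fun a => (f a).2 :=
  Transforms.trans hf (Transforms.right (fun a => toTree (f a).1) fun a => toTree (f a).2)

theorem cons {f : α → β} {g : α → List β} (hf : PolyTime f) (hg : PolyTime g) :
    PolyTime fun a => f a :: g a :=
  Transforms.node hf hg

theorem ite {c : α → Bool} {f g : α → β} (hc : PolyTime c) (hf : PolyTime f) (hg : PolyTime g) :
    PolyTime fun a => if c a then f a else g a := by
  refine Transforms.cases hc ?_ ?_
  · have h : ∀ i : {a // toTree (c a) = Tree.nil}, c i = false := by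
      rintro ⟨a, ha⟩
      by_contra h
      simp [toTree, h] at ha
    simpa [h] using Transforms.comap Subtype.val hg
  · have h : ∀ i : {a // toTree (c a) ≠ Tree.nil}, c i = true := by
      rintro ⟨a, ha⟩
      by_contra h
      simp [toTree, h] at ha
    simpa [h] using Transforms.comap Subtype.val hf

theorem not {f : α → Bool} (hf : PolyTime f) : PolyTime fun a => !f a := by
  convert hf.ite (const false) (const true) using 2 with a
  cases f a <;> rfl

theorem and {f g : α → Bool} (hf : PolyTime f) (hg : PolyTime g) :
    PolyTime fun a => f a && g a := by
  convert hf.ite hg (const false) using 2 with a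
  cases f a <;> rfl

theorem or {f g : α → Bool} (hf : PolyTime f) (hg : PolyTime g) :
    PolyTime fun a => f a || g a := by
  convert hf.ite (const true) hg using 2 with a
  cases f a <;> rfl

/-- Case distinction on a computed list. -/
theorem listCases {l : α → List γ} {f : α → β} {g : α × γ × List γ → β} (hl : PolyTime l)
    (hf : PolyTime f) (hg : PolyTime g) :
    PolyTime fun a => match l a with
      | [] => f a
      | x :: r => g (a, x, r) := by
  refine Transforms.cases hl ?_ ?_
  · have h : ∀ i : {a // toTree (l a) = Tree.nil}, l i = [] := by
      rintro ⟨a, ha⟩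
      cases h : l a with
      | nil => rfl
      | cons x r => simp [toTree, h, listToTree] at ha
    simpa [h] using Transforms.comap Subtype.val hf
  · have h : ∀ i : {a // toTree (l a) ≠ Tree.nil}, ∃ x r, l i = x :: r := by
      rintro ⟨a, ha⟩
      cases h : l a with
      | nil => simp [toTree, h, listToTree] at ha
      | cons x r => exact ⟨x, r, rfl⟩
    choose x r h using h
    have h₁ := Transforms.comap (fun i : {a // toTree (l a) ≠ Tree.nil} => (i : α)) (pair id hl)
    have h₂ := Transforms.comap (fun i : {a // toTree (l a) ≠ Tree.nil} => ((i : α), x i, r i)) hg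
    -- A nonempty list and the pair of its head and tail have the same tree, so the destructuring
    -- costs nothing.
    have h₃ : ∀ i : {a // toTree (l a) ≠ Tree.nil},
        toTree ((i : α), l i) = toTree ((i : α), x i, r i) := fun i => by rw [h i]; rfl
    simp only [h₃] at h₁
    convert h₁.trans h₂ using 2 with i
    simp only [h i]

theorem isEmpty {l : α → List γ} (hl : PolyTime l) : PolyTime fun a => (l a).isEmpty := by
  convert hl.listCases (const true) (g := fun _ => false) (const false) using 2 with a
  cases l a <;> rfl

theorem tail {l : α → List γ} (hl : PolyTime l) : PolyTime fun a => (l a).tail := by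
  convert hl.listCases (const []) (g := fun p => p.2.2) id.snd.snd using 2 with a
  cases l a <;> rfl

/-- Case distinction on a computed letter. -/
theorem letterCases {l : α → Letter} {f : Letter → α → β} (hl : PolyTime l)
    (hf : ∀ x, PolyTime (f x)) : PolyTime fun a => f (l a) a := by
  have h : PolyTime fun a => letterCode (l a) := hl
  convert h.fst.ite (h.snd.ite (hf (.bit true)) (hf (.bit false))) (h.snd.ite (hf .sep) (hf .star))
    using 2 with a
  rcases l a with (_ | _) | _ | _ <;> rfl

end PolyTime

/-! ### Folds over lists with additively growing accumulators. -/

namespace Prog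

/-- Read the root of the left subtree of a node. -/
def peekLeft : Prog := ((pop .main).seq (peek .main)).seq (put .main (.bit true))

/-- Run `p` until the left subtree of the topmost node is empty. -/
def whileLeft (p : Prog) : Prog := peekLeft.seq (loop isNode (p.seq peekLeft))

end Prog

/-- The first letter of the code of a tree. -/
def rootLetter : Tree → Letter
  | .nil => .bit false
  | .node _ _ => .bit true

theorem runs_peekLeft (t u : Tree) (v m x y c) :
    Runs .peekLeft (v, ⟨(Tree.node t u).code ++ m, x, y, c⟩) 3
      (some (rootLetter t), ⟨(Tree.node t u).code ++ m, x, y, c⟩) := by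
  cases t <;> exact .seq (.seq (.pop _ _ _) (.peek _ _ _)) (.push _ _ _ _)

/-- The size of the value of `f` exceeds that of the accumulator by an amount that is polynomial in
the size of the other arguments. -/
def AddsPoly {α β γ : Type} [TreeEncoding α] [TreeEncoding β] [TreeEncoding γ]
    (f : γ → β → α → β) : Prop :=
  ∃ P : Polynomial ℕ, ∀ c b a, treeSize (f c b a) ≤ treeSize b + P.eval (treeSize c + treeSize a)

section Fold

variable {α β γ δ : Type} [TreeEncoding α] [TreeEncoding β] [TreeEncoding γ] [TreeEncoding δ]

theorem treeSize_foldl_le {f : γ → β → α → β} {P : Polynomial ℕ}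
    (hP : ∀ c b a, treeSize (f c b a) ≤ treeSize b + P.eval (treeSize c + treeSize a))
    (c : γ) (b : β) (l : List α) :
    treeSize (l.foldl (f c) b) ≤
      treeSize b + treeSize l * P.eval (treeSize c + treeSize l) := by
  suffices h : ∀ (D : ℕ) (b : β), (∀ a ∈ l, P.eval (treeSize c + treeSize a) ≤ D) →
      treeSize (l.foldl (f c) b) ≤ treeSize b + l.length * D by
    refine (h _ b fun a ha => eval_le_eval P
      (Nat.add_le_add_left (treeSize_le_of_mem ha) _)).trans ?_
    gcongr
    exact length_le_treeSize l
  intro D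
  induction l with
  | nil => simp
  | cons a l ih =>
    intro b hD
    have h₁ := ih (f c b a) fun a' ha' => hD a' (List.mem_cons_of_mem _ ha')
    have h₂ := hP c b a
    have h₃ := hD a List.mem_cons_self
    rw [List.foldl_cons, List.length_cons, Nat.succ_mul]
    omega

/-- The size bound `N` is an invariant: each iteration spends one summand `D` of the budget
`l.length * D` on the growth of the accumulator. So every state has size at most `N`, and an
iteration costs `Q.eval N` plus 4 for the loop test and `peekLeft`. -/
theorem runs_fold_loop {f : γ → β → α → β} {p : Prog} {Q : Polynomial ℕ}
    (hp : ∀ (a : α) (l : List α) (c : γ) (b : β) v m x y k, ∃ v',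
      Runs p (v, ⟨(toTree (a :: l, c, b)).code ++ m, x, y, k⟩)
        (Q.eval (treeSize (a :: l, c, b)))
        (v', ⟨(toTree (l, c, f c b a)).code ++ m, x, y, k⟩))
    (c : γ) (D N : ℕ) (l : List α) (b : β) (hD : ∀ a ∈ l, ∀ b, treeSize (f c b a) ≤ treeSize b + D)
    (hN : treeSize l + treeSize c + treeSize b + l.length * D + 2 ≤ N) (m x y k : List Letter) :
    ∃ v', Runs (.loop isNode (p.seq .peekLeft))
      (some (rootLetter (toTree l)), ⟨(toTree (l, c, b)).code ++ m, x, y, k⟩)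
      (l.length * (Q.eval N + 4) + 1)
      (v', ⟨(toTree (([] : List α), c, l.foldl (f c) b)).code ++ m, x, y, k⟩) := by
  induction l generalizing b with
  | nil => exact ⟨_, .mono (.loop_done rfl) (by omega)⟩
  | cons a l ih =>
    have h₁ := hD a List.mem_cons_self b
    simp only [treeSize_cons, List.length_cons, Nat.succ_mul] at hN
    obtain ⟨v₁, h⟩ := ih (f c b a) (fun a' ha' => hD a' (List.mem_cons_of_mem _ ha')) (by omega)
    obtain ⟨v₂, h₂⟩ := hp a l c b (some (.bit true)) m x y k
    refine ⟨v₁, .mono (.loop_step rfl (.seq h₂ (runs_peekLeft _ _ _ _ _ _ _)) h) ?_⟩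
    have := eval_le_eval Q (m := treeSize (a :: l, c, b)) (n := N) (by
      simp only [treeSize_pair, treeSize_cons]
      have := Nat.zero_le (l.length * D)
      omega)
    rw [List.length_cons, Nat.succ_mul]
    omega

/-- The loop state consists of the remaining list, the parameter and the accumulator, and the loop
ends when the list component is a leaf. By additive growth no state exceeds `n + n * P n` by more
than a constant, where `n` is the initial size, so at most `n` iterations of polynomial cost occur.
-/
theorem PolyTime.foldl_triple {f : γ → β → α → β}
    (hf : PolyTime fun p : γ × β × α => f p.1 p.2.1 p.2.2) (hg : AddsPoly f) :
    PolyTime fun p : List α × γ × β => p.1.foldl (f p.2.1) p.2.2 := by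
  obtain ⟨P, hP⟩ := hg
  have hbody : PolyTime fun p : (α × List α) × γ × β => (p.1.2, p.2.1, f p.2.1 p.2.2 p.1.1) :=
    PolyTime.id.fst.snd.pair (PolyTime.id.snd.fst.pair (hf.comp
      (PolyTime.id.snd.fst.pair (PolyTime.id.snd.snd.pair PolyTime.id.fst.fst))))
  obtain ⟨p, Q, hp⟩ := hbody
  have hloop : PolyTime fun p : List α × γ × β =>
      (([] : List α), p.2.1, p.1.foldl (f p.2.1) p.2.2) := by
    refine ⟨p.whileLeft, 4 + .X + .X * P + .X * (Q.comp (.X + .X * P + 2) + 4), ?_⟩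
    rintro ⟨l, c, b⟩
    have hl := length_le_treeSize l
    have hsize : (toTree (l, c, b)).size = treeSize l + (treeSize c + treeSize b + 1) + 1 := rfl
    generalize hn : (toTree (l, c, b)).size = n at *
    have hPn : treeSize l * P.eval (treeSize c + treeSize l) ≤ n * P.eval n :=
      Nat.mul_le_mul (by omega) (eval_le_eval P (by omega))
    have hPn' : l.length * P.eval n ≤ n * P.eval n := Nat.mul_le_mul_right _ (by omega)
    refine ⟨?_, fun v m x y k => ?_⟩
    · have h := treeSize_foldl_le hP c b l
      change treeSize (([] : List α), c, l.foldl (f c) b) ≤ _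
      simp only [treeSize_pair, treeSize_nil, eval_add, eval_mul, eval_X, eval_ofNat]
      omega
    · obtain ⟨v', h⟩ := runs_fold_loop (f := f) (p := p) (Q := Q)
        (fun a l c b => (hp ((a, l), c, b)).2) c (P.eval n) (n + n * P.eval n + 2) l b
        (fun a ha b => (hP c b a).trans (Nat.add_le_add_left (eval_le_eval P (by
          have := treeSize_le_of_mem ha
          omega)) _)) (by omega) m x y k
      refine ⟨v', .mono (.seq (runs_peekLeft _ _ _ _ _ _ _) h) ?_⟩
      have := Nat.mul_le_mul_right (Q.eval (n + n * P.eval n + 2) + 4) (show l.length ≤ n by omega)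
      simp only [eval_add, eval_mul, eval_X, eval_ofNat, Polynomial.eval_comp]
      omega
  exact hloop.snd.snd

namespace PolyTime

theorem foldl {f : γ → β → α → β} {b : γ → β} {l : γ → List α}
    (hf : PolyTime fun p : γ × β × α => f p.1 p.2.1 p.2.2) (hg : AddsPoly f) (hb : PolyTime b)
    (hl : PolyTime l) : PolyTime fun c => (l c).foldl (f c) (b c) :=
  (foldl_triple hf hg).comp (hl.pair (id.pair hb))

theorem reverse {l : γ → List α} (hl : PolyTime l) : PolyTime fun c => (l c).reverse := by
  have h := foldl (f := fun (_ : γ) (b : List α) a => a :: b) (b := fun _ => []) (l := l)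
    (id.snd.snd.cons id.snd.fst) ⟨.X + 1, fun c b a => by simp; omega⟩ (const _) hl
  simpa using h

theorem foldr {f : γ → α → β → β} {b : γ → β} {l : γ → List α}
    (hf : PolyTime fun p : γ × β × α => f p.1 p.2.2 p.2.1) (hg : AddsPoly fun c b a => f c a b)
    (hb : PolyTime b) (hl : PolyTime l) : PolyTime fun c => (l c).foldr (f c) (b c) := by
  have h := foldl (f := fun c b a => f c a b) hf hg hb hl.reverse
  simpa using h

theorem all {f : γ → α → Bool} {l : γ → List α}
    (hf : PolyTime fun p : γ × α => f p.1 p.2) (hl : PolyTime l) :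
    PolyTime fun c => (l c).all (f c) := by
  have h := foldr (f := fun c a b => f c a && b) (b := fun _ => true) (l := l)
    ((hf.comp (id.fst.pair id.snd.snd)).and id.snd.fst)
    ⟨3, fun c b a => (treeSize_bool_le _).trans (by simp)⟩ (const _) hl
  convert h using 2 with c
  induction l c <;> simp_all

theorem any {f : γ → α → Bool} {l : γ → List α}
    (hf : PolyTime fun p : γ × α => f p.1 p.2) (hl : PolyTime l) :
    PolyTime fun c => (l c).any (f c) := by
  convert (all (f := fun c a => !f c a) hf.not hl).not using 2 with c
  exact List.any_eq_not_all_not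

theorem drop_length {k : γ → List α} {l : γ → List β} (hk : PolyTime k) (hl : PolyTime l) :
    PolyTime fun c => (l c).drop (k c).length := by
  have h := foldl (f := fun (_ : γ) (b : List β) (_ : α) => b.tail) (b := l) (l := k)
    id.snd.fst.tail ⟨0, fun c b a => by cases b <;> simp; omega⟩ hl hk
  convert h using 2 with c
  generalize l c = x
  induction k c generalizing x with
  | nil => rfl
  | cons a k ih => simp [← ih, List.drop_tail]

/-- Lengths are equal iff dropping the length of either list from the other leaves nothing. -/
theorem sameLength {k : γ → List α} {l : γ → List β} (hk : PolyTime k) (hl : PolyTime l) :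
    PolyTime fun c => decide ((k c).length = (l c).length) := by
  convert (drop_length hk hl).isEmpty.and (drop_length hl hk).isEmpty using 2 with c
  rw [Bool.eq_iff_iff]
  simp
  omega

theorem zipWith {f : α → β → δ} (hf : PolyTime fun p : α × β => f p.1 p.2)
    (hd : ∃ N, ∀ a b, treeSize (f a b) ≤ N)
    {k : γ → List α} {l : γ → List β} (hk : PolyTime k) (hl : PolyTime l) :
    PolyTime fun c => List.zipWith f (k c) (l c) := by
  obtain ⟨N, hN⟩ := hd
  -- The accumulator holds the unread part of the second list and the reversed result. The consumed
  -- list node pays for the new one, so a step adds at most the bound `N` on the values of `f`.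
  have h := foldl
    (f := fun (_ : γ) (s : List β × List δ) (a : α) => match s.1 with
      | [] => s
      | b :: r => (r, f a b :: s.2))
    (b := fun c => (l c, [])) (l := k) ?_ ?_ (hl.pair (const _)) hk
  · convert h.snd.reverse using 2 with c
    suffices h : ∀ (k : List α) (s : List β × List δ), (k.foldl (fun s a => match s.1 with
      | [] => s
      | b :: r => (r, f a b :: s.2)) s).2 = (List.zipWith f k s.1).reverse ++ s.2 by
      rw [h]; simp
    intro k
    induction k with
    | nil => simp
    | cons a k ih =>
      rintro ⟨_ | ⟨b, r⟩, t⟩ <;> simp [ih]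
  · exact listCases (l := fun p : γ × (List β × List δ) × α => p.2.1.1)
      (g := fun q => (q.2.2, f q.1.2.2 q.2.1 :: q.1.2.1.2)) id.snd.fst.fst id.snd.fst
      (id.snd.snd.pair ((hf.comp (id.fst.snd.snd.pair id.snd.fst)).cons id.fst.snd.fst.snd))
  · refine ⟨N, ?_⟩
    rintro c ⟨_ | ⟨b, r⟩, t⟩ a
    · simp
    · have := hN a b
      have := treeSize_pos b
      simp; omega

end PolyTime

end Fold

/-! ### From programs on trees to a machine on raw words. -/

instance : Fintype Letter where
  elems := ⟨↑([.bit false, .bit true, .star, .sep] : List Letter), by simp⟩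
  complete a := by rcases a with (_ | _) | _ | _ <;> simp

namespace Prog

/-- Push the code of a fixed tree to the main stack. -/
def pushTree : Tree → Prog
  | .nil => put .main (.bit false)
  | .node l r => ((pushTree r).seq (pushTree l)).seq (put .main (.bit true))

/-- Push the code of the tree that represents the letter read last. -/
def pushLetter : Prog :=
  ite isSep (pushTree (toTree Letter.sep)) (ite isNode (pushTree (toTree (Letter.bit true)))
    (ite (fun v => (v.map letterCode).any Prod.fst) (pushTree (toTree (Letter.bit false)))
      (pushTree (toTree Letter.star))))

/-- Replace a word on the main stack by the code of its tree. -/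
def encodeInput : Prog :=
  ((((pop .main).seq (loop Option.isSome ((push .aux lastRead).seq (pop .main)))).seq
    (put .main (.bit false))).seq (pop .aux)).seq
    (loop Option.isSome ((pushLetter.seq (put .main (.bit true))).seq (pop .aux)))

end Prog

theorem runs_pushTree (t : Tree) (v m x y c) :
    Runs (.pushTree t) (v, ⟨m, x, y, c⟩) t.size (v, ⟨t.code ++ m, x, y, c⟩) := by
  induction t generalizing m with
  | nil => exact .push _ _ _ _
  | node l r hl hr =>
    rw [Tree.code, List.cons_append, List.append_assoc]
    exact .mono (.seq (.seq (hr m) (hl _)) (.push _ _ _ _)) (by simp only [Tree.size]; omega)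

theorem runs_pushLetter (a : Letter) (m x y c) :
    Runs .pushLetter (some a, ⟨m, x, y, c⟩) 10 (some a, ⟨(toTree a).code ++ m, x, y, c⟩) := by
  rcases a with (_ | _) | _ | _
  · exact .mono (.ite_false rfl (.ite_false rfl (.ite_true rfl (runs_pushTree _ _ _ _ _ _))))
      (by decide)
  · exact .mono (.ite_false rfl (.ite_true rfl (runs_pushTree _ _ _ _ _ _))) (by decide)
  · exact .mono (.ite_false rfl (.ite_false rfl (.ite_false rfl (runs_pushTree _ _ _ _ _ _))))
      (by decide)
  · exact .mono (.ite_true rfl (runs_pushTree _ _ _ _ _ _)) (by decide)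

theorem runs_moveInput (w x y c : List Letter) :
    Runs (.loop Option.isSome ((Prog.push .aux lastRead).seq (.pop .main)))
      (w.head?, ⟨w.tail, x, y, c⟩) (1 + 3 * w.length) (none, ⟨[], w.reverse ++ x, y, c⟩) := by
  induction w generalizing x with
  | nil => exact .loop_done rfl
  | cons a w ih =>
    rw [List.reverse_cons, List.append_assoc]
    exact .mono (.loop_step rfl (.seq (.push _ _ _ _) (.pop _ _ _)) (ih _))
      (by simp only [List.length_cons]; omega)

theorem runs_encodeLetters (w w' y c : List Letter) :
    Runs (.loop Option.isSome ((Prog.pushLetter.seq (.put .main (.bit true))).seq (.pop .aux)))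
      (w.head?, ⟨(toTree w').code, w.tail, y, c⟩) (1 + 13 * w.length)
      (none, ⟨(toTree (w.reverse ++ w')).code, [], y, c⟩) := by
  induction w generalizing w' with
  | nil => exact .loop_done rfl
  | cons a w ih =>
    rw [List.reverse_cons, List.append_assoc]
    exact .mono (.loop_step rfl (.seq (.seq (runs_pushLetter _ _ _ _ _) (.push _ _ _ _))
      (.pop _ _ _)) (ih (a :: w'))) (by simp only [List.length_cons]; omega)

/-- The tree of a list is built from its last entry, so the word is first reversed onto `aux`. -/
theorem runs_encodeInput (w : List Letter) :
    Runs .encodeInput (none, ⟨w, [], [], []⟩) (5 + 16 * w.length)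
      (none, ⟨(toTree w).code, [], [], []⟩) := by
  have h₁ := runs_moveInput w [] [] []
  have h₂ := runs_encodeLetters w.reverse [] [] []
  rw [List.reverse_reverse, List.append_nil] at h₂
  rw [List.append_nil] at h₁
  refine .mono (.seq (.seq (.seq (.seq (.pop _ _ _) h₁) (.push _ _ _ _)) (.pop _ _ _)) h₂) ?_
  simp only [List.length_reverse]
  omega

theorem treeSize_word_le (w : List Letter) : treeSize w ≤ 8 * w.length + 1 := by
  induction w with
  | nil => simp
  | cons a w ih =>
    have := treeSize_letter_le a
    simp only [treeSize_cons, List.length_cons]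
    omega

/-- The statement that moves the truth value on the main stack to the output stack and halts. -/
def outputStmt (L : Type) : MStmt L :=
  .pop (some .main) (fun _ a => a) <| .branch isNode
    (.push none (fun _ => true) <| .pop (some .main) (fun _ _ => none) <|
      .pop (some .main) (fun _ _ => none) .halt)
    (.push none (fun _ => false) <| .load (fun _ => none) .halt)

/-- The machine that runs the program `p` on the tree of the input word and outputs the truth value
found on the main stack. -/
def decider (p : Prog) : FinTM2 where
  K := Option Reg
  k₀ := some .main
  k₁ := none
  Γ := Alphabet
  Λ := Option (Prog.encodeInput.seq p).Label
  main := some (Prog.encodeInput.seq p).entry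
  σ := Option Letter
  initialState := none
  Γk₀Fin := inferInstanceAs (Fintype Letter)
  m
    | some l => (Prog.encodeInput.seq p).code some none l
    | none => outputStmt _

/-- The bound adds the linear cost of encoding the input, the cost of `p` on a tree of size at most
`8 * w.length + 1`, and one step for the output, as a single `TM2` statement may chain several stack
operations. -/
theorem decider_outputs {f : List Letter → Bool} {p : Prog} {P : Polynomial ℕ} {w : List Letter}
    (hp : ∀ v m x y c, ∃ v', Runs p (v, ⟨(toTree w).code ++ m, x, y, c⟩) (P.eval (treeSize w))
      (v', ⟨(toTree (f w)).code ++ m, x, y, c⟩)) :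
    ∃ k ≤ (6 + 16 * .X + P.comp (8 * .X + 1)).eval w.length,
      (flip bind (decider p).step)^[k] (some (initList (decider p) w)) =
        some (haltList (decider p) [f w]) := by
  obtain ⟨v, hv⟩ := hp none [] [] [] []
  simp only [List.append_nil] at hv
  have h₁ := ((runs_encodeInput w).seq hv).reaches (decider p).m some none fun _ => rfl
  have h₂ : ReachesWithin (decider p).m
      (progCfg none (v, ⟨(toTree (f w)).code, [], [], []⟩)) 1
      (haltList (decider p) [f w]) := by
    refine .single ?_
    -- The halting configuration requires empty working stacks and a reset variable. The code of
    -- `false` is one letter and that of `true` three, which is why `outputStmt` pops twice more in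
    -- the latter case.
    cases f w
    · refine congrArg some (congrArg (TM2.Cfg.mk none none) ?_)
      funext k
      rcases k with _ | _ | _ | _ | _ <;> rfl
    · refine congrArg some (congrArg (TM2.Cfg.mk none none) ?_)
      funext k
      rcases k with _ | _ | _ | _ | _ <;> rfl
  have h₀ : initList (decider p) w =
      progCfg (some (Prog.encodeInput.seq p).entry) (none, ⟨w, [], [], []⟩) := by
    refine congrArg (TM2.Cfg.mk _ none) ?_
    funext k
    rcases k with _ | _ | _ | _ | _ <;> rfl
  obtain ⟨k, hk, h⟩ := h₁.trans h₂
  have hP := eval_le_eval P (treeSize_word_le w)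
  refine ⟨k, hk.trans ?_,
    (congrArg (fun c => (flip bind (decider p).step)^[k] (some c)) h₀).trans h⟩
  simp only [eval_add, eval_mul, eval_X, eval_ofNat, Polynomial.eval_comp, Polynomial.eval_one]
  omega

theorem PolyTime.computable {f : List Letter → Bool} (hf : PolyTime f) :
    Nonempty (TM2ComputableInPolyTime (_root_.id : List Letter → List Letter)
      Computability.encodeBool f) := by
  obtain ⟨p, P, hp⟩ := hf
  have h : ∀ w : List Letter, Nonempty (TM2OutputsInTime (decider p)
      (w.map (Equiv.refl Letter).invFun) (some ([f w].map (Equiv.refl Bool).invFun))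
      ((6 + 16 * .X + P.comp (8 * .X + 1)).eval w.length)) := fun w => by
    obtain ⟨k, hk, h⟩ := decider_outputs (f := f) (hp w).2
    have hw : w.map (Equiv.refl Letter).invFun = w := List.map_id' w
    exact ⟨⟨⟨k, (congrArg (fun u : List Letter => (flip bind (decider p).step)^[k]
      (some (initList (decider p) u))) hw).trans h⟩, hk⟩⟩
  generalize 6 + 16 * .X + P.comp (8 * .X + 1) = T at h
  exact ⟨⟨⟨decider p, Equiv.refl Letter, Equiv.refl Bool⟩, T, fun w => (h w).some⟩⟩

/-! ### The decision procedures on words. -/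

/-- Words over the alphabet of instances. -/
abbrev Word : Type := List Letter

/-- The words that are followed by a separator in `w`. -/
def splitWords (w : Word) : List Word :=
  w.foldr (fun a r => if isSep (some a) then [] :: r else match r with
    | [] => [[a]]
    | x :: r => (a :: x) :: r) []

/-- Is the last letter of `w` a separator? -/
def endsWithSep (w : Word) : Bool := w.foldl (fun _ a => isSep (some a)) false

/-- Group words in pairs, from the end of the list; a first word may be left over. -/
def pairUp (ws : List Word) : List Word × List (Word × Word) :=
  ws.foldr (fun x s => match s.1 with
    | [] => ([x], s.2)
    | y :: _ => ([], (x, y) :: s.2)) ([], [])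

/-- The order of the entries of sub-hypercubes. -/
def leLetter : Letter → Letter → Bool
  | _, .star => true
  | .bit a, .bit b => a == b
  | .sep, .sep => true
  | _, _ => false

/-- The least upper bound of two entries of sub-hypercubes. -/
def joinLetter (a b : Letter) : Letter :=
  if leLetter a b then b else if leLetter b a then a else .star

/-- Inclusion of sub-hypercubes. -/
def leWord (u v : Word) : Bool := (List.zipWith leLetter u v).all fun b => b

/-- The smallest sub-hypercube that contains two others. -/
def joinWord (u v : Word) : Word := List.zipWith joinLetter u v

/-- Add to the sub-hypercube `c` the targets of the edges with source in it, one after the other. -/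
def pass (es : List (Word × Word)) (c : Word) : Word :=
  es.foldl (fun c e => if leWord e.1 c then joinWord c e.2 else c) c

/-- The smallest trap space that contains the sub-hypercube `c`. -/
def closureWord (es : List (Word × Word)) (c : Word) : Word := c.foldl (fun b _ => pass es b) c

/-- Does `w` consist of bits? -/
def isBits (w : Word) : Bool := w.all fun a => (letterCode a).1

/-- Do the edges have pairwise distinct sources? -/
def distinctSources (es : List (Word × Word)) : Bool :=
  (es.foldr (fun e s => (s.1 && !s.2.any fun x => leWord e.1 x, e.1 :: s.2))
    (true, ([] : List Word))).1

/-- Halve `m` as many times as the word `h` has letters; the truth value tells whether all these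
divisions were exact. -/
def halvings (h : Word) (m : ℕ) : Bool × ℕ :=
  h.foldl (fun s _ => (s.1 && !decide (s.2 % 2 = 1), s.2 / 2)) (true, m)

/-- Is `es` the list of edges of a functional graph, of the dimension given by the length of `h`? -/
def isGraph (h : Word) (es : List (Word × Word)) : Bool :=
  (es.all fun e => (isBits e.1 && isBits e.2) &&
    (decide (e.1.length = h.length) && decide (e.2.length = h.length))) &&
  (distinctSources es && ((halvings h es.length).1 && decide ((halvings h es.length).2 = 1)))

/-- Decide whether a word encodes an instance with the property `check`. -/
def decideInstance (check : Word × List (Word × Word) → Bool) (w : Word) : Bool :=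
  -- Grouping from the end leaves a first word over iff the number of words is odd; that word is the
  -- cube, and the pairs are the edges.
  endsWithSep w && match (pairUp (splitWords w)).1 with
    | [] => false
    | h :: _ => isGraph h (pairUp (splitWords w)).2 && check (h, (pairUp (splitWords w)).2)

/-- The check for TRAPSPACE. -/
def checkTrap (p : Word × List (Word × Word)) : Bool := leWord (closureWord p.2 p.1) p.1

/-- The check for MINTRAP. -/
def checkMinTrap (p : Word × List (Word × Word)) : Bool :=
  p.2.all fun e => !leWord e.1 p.1 ||
    (leWord (closureWord p.2 e.1) p.1 && leWord p.1 (closureWord p.2 e.1))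

/-- The check for IN-MINTRAP. -/
def checkInMinTrap (p : Word × List (Word × Word)) : Bool :=
  isBits p.1 && checkMinTrap (closureWord p.2 p.1, p.2)

/-! ### The procedures run in polynomial time. -/

section PolyTime

open PolyTime

variable {γ : Type} [TreeEncoding γ]

/-- The alphabet is finite, so any `f` whatsoever is a table of constants. -/
theorem polyTime_letter {β : Type} [TreeEncoding β] (f : Letter → β) {a : γ → Letter}
    (ha : PolyTime a) : PolyTime fun c => f (a c) :=
  letterCases (f := fun x _ => f x) ha fun _ => const _

theorem polyTime_letter₂ {β : Type} [TreeEncoding β] (f : Letter → Letter → β) {a b : γ → Letter}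
    (ha : PolyTime a) (hb : PolyTime b) : PolyTime fun c => f (a c) (b c) :=
  letterCases (f := fun x c => f x (b c)) ha fun x => polyTime_letter (f x) hb

theorem polyTime_splitWords : PolyTime splitWords := by
  refine foldr (f := fun (_ : Word) a (r : List Word) => if isSep (some a) then [] :: r else
    match r with
    | [] => [[a]]
    | x :: r => (a :: x) :: r) (b := fun _ => []) (l := fun w => w) ?_ ?_ (const _) id
  · convert (polyTime_letter (fun a => isSep (some a)) id.snd.snd).ite
      ((const []).cons id.snd.fst)
      (listCases (l := fun p : Word × List Word × Letter => p.2.1)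
        (g := fun q => (q.1.2.2 :: q.2.1) :: q.2.2)
        id.snd.fst ((id.snd.snd.cons (const [])).cons (const []))
        ((id.fst.snd.snd.cons id.snd.fst).cons id.snd.snd)) using 2 with p
    rcases p with ⟨_, _ | _, _⟩ <;> rfl
  · refine ⟨.X + 10, fun c r a => ?_⟩
    dsimp only
    split_ifs
    · simp only [treeSize_cons, treeSize_nil, eval_add, eval_X, eval_ofNat]
      omega
    · cases r <;> simp only [treeSize_cons, treeSize_nil, eval_add, eval_X, eval_ofNat] <;> omega

theorem polyTime_endsWithSep : PolyTime endsWithSep :=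
  foldl (f := fun (_ : Word) (_ : Bool) a => isSep (some a)) (b := fun _ => false) (l := fun w => w)
    (polyTime_letter (fun a => isSep (some a)) id.snd.snd)
    ⟨3, fun _ _ _ => (treeSize_bool_le _).trans (by simp)⟩ (const _) id

theorem polyTime_pairUp : PolyTime pairUp := by
  refine foldr (f := fun (_ : List Word) x (s : List Word × List (Word × Word)) => match s.1 with
    | [] => ([x], s.2)
    | y :: _ => ([], (x, y) :: s.2)) (b := fun _ => ([], [])) (l := fun w => w) ?_ ?_ (const _) id
  · convert listCases
      (l := fun p : List Word × (List Word × List (Word × Word)) × Word => p.2.1.1)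
      (g := fun q => ([], (q.1.2.2, q.2.1) :: q.1.2.1.2)) id.snd.fst.fst
      ((id.snd.snd.cons (const [])).pair id.snd.fst.snd)
      ((const []).pair ((id.fst.snd.snd.pair id.snd.fst).cons id.fst.snd.fst.snd)) using 2 with p
    rcases p with ⟨_, ⟨_ | _, _⟩, _⟩ <;> rfl
  · refine ⟨.X + 10, ?_⟩
    rintro c ⟨_ | ⟨y, t⟩, r⟩ x <;>
      simp only [treeSize_cons, treeSize_nil, treeSize_pair, eval_add, eval_X, eval_ofNat] <;> omega

theorem polyTime_leWord {u v : γ → Word} (hu : PolyTime u) (hv : PolyTime v) :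
    PolyTime fun c => leWord (u c) (v c) :=
  all (f := fun _ b => b) id.snd
    (zipWith (polyTime_letter₂ _ id.fst id.snd) ⟨3, fun _ _ => treeSize_bool_le _⟩ hu hv)

theorem polyTime_joinWord {u v : γ → Word} (hu : PolyTime u) (hv : PolyTime v) :
    PolyTime fun c => joinWord (u c) (v c) :=
  zipWith (polyTime_letter₂ _ id.fst id.snd) ⟨7, fun _ _ => treeSize_letter_le _⟩ hu hv

/-- The join is no longer than `v`. A bound free of `u`, which plays the accumulator in `pass`, is
what `AddsPoly` asks for. -/
theorem treeSize_joinWord_le (u v : Word) : treeSize (joinWord u v) ≤ 8 * treeSize v + 1 := by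
  refine (treeSize_word_le _).trans ?_
  have := length_le_treeSize v
  simp only [joinWord, List.length_zipWith]
  omega

theorem treeSize_addTarget_le (γ : Type) [TreeEncoding γ] (c : γ) (b : Word) (e : Word × Word) :
    treeSize (if leWord e.1 b then joinWord b e.2 else b) ≤
      treeSize b + (8 * .X + 1 : Polynomial ℕ).eval (treeSize c + treeSize e) := by
  have := treeSize_joinWord_le b e.2
  simp only [eval_add, eval_mul, eval_X, eval_ofNat, Polynomial.eval_one, treeSize_pair]
  split_ifs <;> omega

theorem polyTime_pass {es : γ → List (Word × Word)} {w : γ → Word} (he : PolyTime es)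
    (hw : PolyTime w) : PolyTime fun c => pass (es c) (w c) :=
  foldl (f := fun (_ : γ) (c : Word) (e : Word × Word) =>
    if leWord e.1 c then joinWord c e.2 else c)
    ((polyTime_leWord id.snd.snd.fst id.snd.fst).ite
      (polyTime_joinWord id.snd.fst id.snd.snd.snd) id.snd.fst)
    ⟨_, treeSize_addTarget_le γ⟩ hw he

theorem polyTime_closureWord {es : γ → List (Word × Word)} {w : γ → Word} (he : PolyTime es)
    (hw : PolyTime w) : PolyTime fun c => closureWord (es c) (w c) := by
  refine comp (g := fun p : List (Word × Word) × Word => closureWord p.1 p.2) ?_ (he.pair hw)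
  refine foldl (f := fun (p : List (Word × Word) × Word) b (_ : Letter) => pass p.1 b)
    (polyTime_pass id.fst.fst id.snd.fst) ?_ id.snd id.snd
  -- A whole pass is one step of the outer fold; its additive growth is the growth per edge times a
  -- bound on the number of edges.
  refine ⟨.X * (8 * .X + 1), fun p b a => ?_⟩
  refine (treeSize_foldl_le (treeSize_addTarget_le Unit) () b p.1).trans ?_
  have h₁ : treeSize p.1 ≤ treeSize p + treeSize a := by rw [treeSize_pair]; omega
  have h₂ : treeSize () + treeSize p.1 ≤ treeSize p + treeSize a := by
    have : treeSize () = 1 := rfl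
    rw [treeSize_pair]; omega
  rw [eval_mul, eval_X]
  gcongr
  exact eval_le_eval _ h₂

theorem polyTime_isBits {w : γ → Word} (hw : PolyTime w) : PolyTime fun c => isBits (w c) :=
  all (f := fun _ a => (letterCode a).1) (polyTime_letter (fun a => (letterCode a).1) id.snd) hw

theorem polyTime_distinctSources {es : γ → List (Word × Word)} (he : PolyTime es) :
    PolyTime fun c => distinctSources (es c) := by
  refine fst (foldr (f := fun (_ : γ) (e : Word × Word) (s : Bool × List Word) =>
    (s.1 && !s.2.any fun x => leWord e.1 x, e.1 :: s.2)) ?_ ?_ (const _) he)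
  · exact (id.snd.fst.fst.and (any (f := fun (p : γ × (Bool × List Word) × Word × Word) x =>
      leWord p.2.2.1 x) (polyTime_leWord id.fst.snd.snd.fst id.snd) id.snd.fst.snd).not).pair
      (id.snd.snd.fst.cons id.snd.fst.snd)
  · refine ⟨.X + 10, ?_⟩
    rintro c s e
    have := treeSize_bool_le (s.1 && !s.2.any fun x => leWord e.1 x)
    simp only [treeSize_cons, treeSize_pair, eval_add, eval_X, eval_ofNat]
    omega

theorem polyTime_length {α : Type} [TreeEncoding α] {l : γ → List α} (hl : PolyTime l) :
    PolyTime fun c => (l c).length := by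
  have h := foldl (f := fun (_ : γ) (n : ℕ) (_ : α) => n + 1) (b := fun _ => 0) (l := l)
    (cons (β := Unit) (const ()) id.snd.fst) ⟨2, fun c b a => by simp [treeSize_nat]; omega⟩
    (const _) hl
  convert h using 2 with c
  suffices h : ∀ (l : List α) (n : ℕ), l.foldl (fun n _ => n + 1) n = n + l.length by simp [h]
  intro l
  induction l with
  | nil => simp
  | cons a l ih => intro n; simp [ih]; omega

/-- Running through the unary number, a flag records the parity and the quotient increases at every
second entry. -/
theorem polyTime_divMod {n : γ → ℕ} (hn : PolyTime n) :
    PolyTime fun c => (decide (n c % 2 = 1), n c / 2) := by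
  have hr : PolyTime fun c => List.replicate (n c) () := hn
  have h := foldl (f := fun (_ : γ) (s : Bool × ℕ) (_ : Unit) =>
      (!s.1, if s.1 then s.2 + 1 else s.2))
    (b := fun _ => (false, 0)) (l := fun c => List.replicate (n c) ())
    (id.snd.fst.fst.not.pair
      (id.snd.fst.fst.ite (cons (β := Unit) (const ()) id.snd.fst.snd) id.snd.fst.snd))
    ⟨10, fun c b a => by
      have := treeSize_bool_le (!b.1)
      simp only [treeSize_pair, treeSize_nat, eval_ofNat]
      split_ifs <;> omega⟩ (const _) hr
  convert h using 2 with c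
  induction n c with
  | zero => rfl
  | succ m ih =>
    rw [List.replicate_succ', List.foldl_append, ← ih]
    rcases Nat.mod_two_eq_zero_or_one m with h | h
    · simp only [List.foldl_cons, List.foldl_nil, h]
      refine Prod.ext ?_ ?_ <;> simp <;> omega
    · simp only [List.foldl_cons, List.foldl_nil, h]
      refine Prod.ext ?_ ?_ <;> simp <;> omega

theorem polyTime_eq_one {n : γ → ℕ} (hn : PolyTime n) : PolyTime fun c => decide (n c = 1) := by
  have hr : PolyTime fun c => List.replicate (n c) () := hn
  convert hr.isEmpty.not.and hr.tail.isEmpty using 2 with c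
  rcases n c with _ | _ | m <;> simp [List.replicate_succ]

theorem polyTime_halvings {h : γ → Word} {m : γ → ℕ} (hh : PolyTime h) (hm : PolyTime m) :
    PolyTime fun c => halvings (h c) (m c) := by
  refine foldl (f := fun (_ : γ) (s : Bool × ℕ) (_ : Letter) =>
    (s.1 && !decide (s.2 % 2 = 1), s.2 / 2)) ?_ ?_ ((const true).pair hm) hh
  · have h := polyTime_divMod (γ := γ × (Bool × ℕ) × Letter) id.snd.fst.snd
    exact (id.snd.fst.fst.and h.fst.not).pair h.snd
  · refine ⟨10, fun c s a => ?_⟩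
    have := treeSize_bool_le (s.1 && !decide (s.2 % 2 = 1))
    simp only [treeSize_pair, treeSize_nat, eval_ofNat]
    omega

theorem polyTime_isGraph {h : γ → Word} {es : γ → List (Word × Word)} (hh : PolyTime h)
    (he : PolyTime es) : PolyTime fun c => isGraph (h c) (es c) := by
  have h₁ := polyTime_halvings hh (polyTime_length he)
  refine (all (f := fun c (e : Word × Word) => (isBits e.1 && isBits e.2) &&
    (decide (e.1.length = (h c).length) && decide (e.2.length = (h c).length))) ?_ he).and
    ((polyTime_distinctSources he).and (h₁.fst.and (polyTime_eq_one h₁.snd)))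
  exact ((polyTime_isBits id.snd.fst).and (polyTime_isBits id.snd.snd)).and
    ((sameLength id.snd.fst (hh.comp id.fst)).and (sameLength id.snd.snd (hh.comp id.fst)))

theorem polyTime_decideInstance {check : Word × List (Word × Word) → Bool}
    (hc : PolyTime check) : PolyTime (decideInstance check) := by
  have h := polyTime_pairUp.comp polyTime_splitWords
  have hes : PolyTime fun q : Word × Word × List Word => (pairUp (splitWords q.1)).2 :=
    (h.comp id.fst).snd
  convert polyTime_endsWithSep.and (listCases
    (g := fun q => isGraph q.2.1 (pairUp (splitWords q.1)).2 &&
      check (q.2.1, (pairUp (splitWords q.1)).2)) h.fst (const false)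
    ((polyTime_isGraph id.snd.fst hes).and (hc.comp (id.snd.fst.pair hes)))) using 2 with w
  rw [decideInstance]
  cases (pairUp (splitWords w)).1 <;> rfl

theorem polyTime_checkTrap : PolyTime checkTrap :=
  polyTime_leWord (polyTime_closureWord id.snd id.fst) id.fst

theorem polyTime_checkMinTrap : PolyTime checkMinTrap := by
  have h : PolyTime fun q : (Word × List (Word × Word)) × Word × Word =>
      closureWord q.1.2 q.2.1 := polyTime_closureWord id.fst.snd id.snd.fst
  exact all (f := fun (p : Word × List (Word × Word)) e => !leWord e.1 p.1 ||
    (leWord (closureWord p.2 e.1) p.1 && leWord p.1 (closureWord p.2 e.1)))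
    ((polyTime_leWord id.snd.fst id.fst.fst).not.or
      ((polyTime_leWord h id.fst.fst).and (polyTime_leWord id.fst.fst h))) id.snd

theorem polyTime_checkInMinTrap : PolyTime checkInMinTrap :=
  (polyTime_isBits id.fst).and
    (polyTime_checkMinTrap.comp ((polyTime_closureWord id.snd id.fst).pair id.snd))

end PolyTime

/-! ### Parsing words. -/

section Parsing

/-- The word made of the given words, each followed by a separator. -/
def joinSep (ws : List Word) : Word := ws.flatMap fun x => x ++ [.sep]

theorem isSep_iff (a : Letter) : isSep (some a) = true ↔ a = .sep := by
  rcases a with _ | _ | _ <;> simp [isSep]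

theorem splitWords_append {x : Word} (hx : .sep ∉ x) (w : Word) :
    splitWords (x ++ .sep :: w) = x :: splitWords w := by
  induction x with
  | nil => simp [splitWords, isSep]
  | cons a x ih =>
    rw [List.mem_cons, not_or] at hx
    have ha : isSep (some a) = false := by
      rw [Bool.eq_false_iff, ne_eq, isSep_iff]
      exact Ne.symm hx.1
    have := ih hx.2
    simp only [splitWords] at this
    simp [splitWords, ha, this]

theorem splitWords_joinSep {ws : List Word} (hws : ∀ x ∈ ws, .sep ∉ x) :
    splitWords (joinSep ws) = ws := by
  induction ws with
  | nil => rfl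
  | cons x ws ih =>
    have h := splitWords_append (hws x List.mem_cons_self) (joinSep ws)
    rw [ih fun y hy => hws y (List.mem_cons_of_mem _ hy)] at h
    simpa [joinSep] using h

theorem endsWithSep_append (w : Word) (a : Letter) : endsWithSep (w ++ [a]) = isSep (some a) := by
  simp [endsWithSep]

theorem endsWithSep_joinSep {x : Word} {ws : List Word} :
    endsWithSep (joinSep (x :: ws)) = true := by
  induction ws generalizing x with
  | nil => simp [joinSep, endsWithSep_append, isSep]
  | cons y ws ih =>
    rcases List.eq_nil_or_concat (joinSep (y :: ws)) with h | ⟨v, a, h⟩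
    · simp [joinSep] at h
    · have h₁ := ih (x := y)
      rw [h, List.concat_eq_append, endsWithSep_append] at h₁
      have h₂ : joinSep (x :: y :: ws) = (x ++ [.sep] ++ v) ++ [a] := by
        rw [show joinSep (x :: y :: ws) = x ++ [.sep] ++ joinSep (y :: ws) from rfl, h]
        simp
      rw [h₂, endsWithSep_append, h₁]

theorem exists_joinSep_of_endsWithSep {w : Word} (hw : endsWithSep w = true) :
    ∃ ws : List Word, (∀ x ∈ ws, .sep ∉ x) ∧ w = joinSep ws := by
  rcases List.eq_nil_or_concat w with rfl | ⟨v, a, rfl⟩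
  · simp [endsWithSep] at hw
  rw [List.concat_eq_append, endsWithSep_append, isSep_iff] at hw
  subst hw
  rw [List.concat_eq_append]
  induction v with
  | nil => exact ⟨[[]], by simp, by simp [joinSep]⟩
  | cons a v ih =>
    obtain ⟨ws, hws, h⟩ := ih
    by_cases ha : a = .sep
    · subst ha
      exact ⟨[] :: ws, by simpa using hws, by rw [List.cons_append, h]; rfl⟩
    · rcases ws with _ | ⟨x, ws⟩
      · simp [joinSep] at h
      · refine ⟨(a :: x) :: ws, ?_, by rw [List.cons_append, h]; rfl⟩
        rw [List.forall_mem_cons] at hws ⊢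
        rw [List.mem_cons, not_or]
        exact ⟨⟨Ne.symm ha, hws.1⟩, hws.2⟩

/-- The endpoints of a list of edges. -/
def endpoints (es : List (Word × Word)) : List Word := es.flatMap fun e => [e.1, e.2]

theorem pairUp_endpoints (es : List (Word × Word)) : pairUp (endpoints es) = ([], es) := by
  induction es with
  | nil => rfl
  | cons e es ih =>
    simp only [pairUp, endpoints] at ih
    simp [pairUp, endpoints, ih]

theorem pairUp_cons_endpoints (h : Word) (es : List (Word × Word)) :
    pairUp (h :: endpoints es) = ([h], es) := by
  have := pairUp_endpoints es
  simp only [pairUp] at this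
  simp [pairUp, this]

theorem eq_of_pairUp (ws : List Word) :
    ws = (pairUp ws).1 ++ endpoints (pairUp ws).2 ∧ (pairUp ws).1.length ≤ 1 := by
  induction ws with
  | nil => exact ⟨rfl, by simp [pairUp]⟩
  | cons x ws ih =>
    have hx : pairUp (x :: ws) = match (pairUp ws).1 with
      | [] => ([x], (pairUp ws).2)
      | y :: _ => ([], (x, y) :: (pairUp ws).2) := rfl
    rw [hx]
    generalize pairUp ws = s at ih ⊢
    obtain ⟨_ | ⟨y, t⟩, es⟩ := s
    · simpa using ih.1
    · have ht : t = [] := by simpa using ih.2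
      subst ht
      refine ⟨?_, by simp⟩
      rw [ih.1]
      rfl

/-- Splitting at separators inverts `joinSep` on separator-free words, and pairing inverts
`endpoints`; hence an accepted word is exactly the encoding of what was parsed from it. -/
theorem decideInstance_iff (check : Word × List (Word × Word) → Bool) (w : Word) :
    decideInstance check w = true ↔ ∃ (h : Word) (es : List (Word × Word)),
      .sep ∉ h ∧ (∀ e ∈ es, .sep ∉ e.1 ∧ .sep ∉ e.2) ∧ w = joinSep (h :: endpoints es) ∧
        isGraph h es = true ∧ check (h, es) = true := by
  constructor
  · intro hw
    rw [decideInstance, Bool.and_eq_true] at hw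
    obtain ⟨ws, hws, rfl⟩ := exists_joinSep_of_endsWithSep hw.1
    have h₂ := hw.2
    rw [splitWords_joinSep hws] at h₂
    obtain ⟨h₃, h₄⟩ := eq_of_pairUp ws
    generalize pairUp ws = s at h₂ h₃ h₄
    obtain ⟨_ | ⟨h, t⟩, es⟩ := s
    · simp at h₂
    · have ht : t = [] := by simpa using h₄
      subst ht h₃
      refine ⟨h, es, hws h (by simp), fun e he => ⟨hws _ ?_, hws _ ?_⟩, rfl, by simpa using h₂⟩
      · simp only [endpoints, List.mem_append, List.mem_flatMap]
        exact Or.inr ⟨e, he, by simp⟩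
      · simp only [endpoints, List.mem_append, List.mem_flatMap]
        exact Or.inr ⟨e, he, by simp⟩
  · rintro ⟨h, es, hh, hes, rfl, h₁, h₂⟩
    have hws : ∀ x ∈ h :: endpoints es, .sep ∉ x := by
      simp only [List.forall_mem_cons, endpoints, List.mem_flatMap]
      refine ⟨hh, ?_⟩
      rintro x ⟨e, he, hx⟩
      simp only [List.mem_cons, List.not_mem_nil, or_false] at hx
      rcases hx with rfl | rfl
      · exact (hes e he).1
      · exact (hes e he).2
    rw [decideInstance, endsWithSep_joinSep, splitWords_joinSep hws, pairUp_cons_endpoints]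
    simp [h₁, h₂]

end Parsing

/-! ### The lattice operations on sub-hypercubes and on their words. -/

section Cubes

variable {n : ℕ}

/-- The entries of a sub-hypercube as a word. -/
def cubeWord (h : SubHypercube n) : Word := List.ofFn fun i => (h i).elim Letter.star Letter.bit

/-- A configuration as a sub-hypercube. -/
def pointCube (x : Config n) : SubHypercube n := fun i => some (x i)

/-- The entrywise order of sub-hypercubes. -/
def CubeLE (g h : SubHypercube n) : Prop := ∀ i, h i = none ∨ g i = h i

/-- The least upper bound of two sub-hypercubes. -/
def cubeJoin (g h : SubHypercube n) : SubHypercube n := fun i => if g i = h i then g i else none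

theorem CubeLE.refl (h : SubHypercube n) : CubeLE h h := fun _ => Or.inr rfl

theorem CubeLE.trans {g h k : SubHypercube n} (h₁ : CubeLE g h) (h₂ : CubeLE h k) :
    CubeLE g k := by
  intro i
  rcases h₂ i with h | h
  · exact Or.inl h
  · rcases h₁ i with h' | h'
    · exact Or.inl (h ▸ h')
    · exact Or.inr (h'.trans h)

theorem CubeLE.antisymm {g h : SubHypercube n} (h₁ : CubeLE g h) (h₂ : CubeLE h g) : g = h := by
  funext i
  rcases h₁ i with h | h
  · rcases h₂ i with h' | h'
    · rw [h, h']
    · exact h'.symm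
  · exact h

theorem cubeLE_join_left (g h : SubHypercube n) : CubeLE g (cubeJoin g h) := by
  intro i
  by_cases hi : g i = h i <;> simp [cubeJoin, hi]

theorem cubeLE_join_right (g h : SubHypercube n) : CubeLE h (cubeJoin g h) := by
  intro i
  by_cases hi : g i = h i <;> simp [cubeJoin, hi]

theorem cubeJoin_le {g h k : SubHypercube n} (h₁ : CubeLE g k) (h₂ : CubeLE h k) :
    CubeLE (cubeJoin g h) k := by
  intro i
  rcases h₁ i with h | h
  · exact Or.inl h
  · rcases h₂ i with h' | h'
    · exact Or.inl h'
    · simp [cubeJoin, h, h']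

theorem mem_vertices_iff {x : Config n} {h : SubHypercube n} :
    x ∈ vertices h ↔ CubeLE (pointCube x) h := by
  simp only [vertices, Set.mem_ofPred_eq, CubeLE, pointCube, or_iff_not_imp_left, ne_eq]

theorem cubeLE_iff {g h : SubHypercube n} : CubeLE g h ↔ vertices g ⊆ vertices h := by
  constructor
  · intro hgh x hx
    exact mem_vertices_iff.2 ((mem_vertices_iff.1 hx).trans hgh)
  · intro hgh i
    by_contra hi
    rw [not_or] at hi
    obtain ⟨b, hb⟩ := Option.ne_none_iff_exists'.1 hi.1
    -- Filling the free entries of `g` with the opposite of `b = h i` gives a vertex of `g` that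
    -- differs from `h` at `i`, since `g i` is not `b`.
    have hx : (fun j => (g j).getD !b) ∈ vertices g := by
      intro j hj
      obtain ⟨a, ha⟩ := Option.ne_none_iff_exists'.1 hj
      simp [ha]
    have h₁ := hgh hx i hi.1
    rw [hb] at h₁ hi
    cases hg : g i with
    | none => simp [hg] at h₁
    | some a => simp_all

theorem vertices_nonempty (h : SubHypercube n) : (vertices h).Nonempty := by
  refine ⟨fun j => (h j).getD true, fun j hj => ?_⟩
  obtain ⟨a, ha⟩ := Option.ne_none_iff_exists'.1 hj
  simp [ha]

theorem length_cubeWord (h : SubHypercube n) : (cubeWord h).length = n := by simp [cubeWord]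

theorem sep_notMem_cubeWord (h : SubHypercube n) : .sep ∉ cubeWord h := by
  rw [cubeWord, List.mem_ofFn]
  rintro ⟨i, hi⟩
  cases h' : h i <;> simp [h'] at hi

theorem leWord_cubeWord {g h : SubHypercube n} :
    leWord (cubeWord g) (cubeWord h) = true ↔ CubeLE g h := by
  have key : ∀ i, leLetter ((g i).elim Letter.star Letter.bit) ((h i).elim Letter.star Letter.bit) =
      true ↔ h i = none ∨ g i = h i := by
    intro i
    rcases g i with _ | _ | _ <;> rcases h i with _ | _ | _ <;> simp [leLetter]
  simp only [leWord, List.all_eq_true, List.forall_mem_iff_getElem, cubeWord,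
    List.length_zipWith, List.length_ofFn, List.getElem_zipWith, List.getElem_ofFn, key, CubeLE]
  exact ⟨fun H i => H i (by simp), fun H i hi => H ⟨i, by simpa using hi⟩⟩

theorem joinWord_cubeWord (g h : SubHypercube n) :
    joinWord (cubeWord g) (cubeWord h) = cubeWord (cubeJoin g h) := by
  apply List.ext_getElem
  · simp [joinWord, cubeWord]
  · intro i h₁ h₂
    simp only [joinWord, cubeWord, List.getElem_zipWith, List.getElem_ofFn, cubeJoin]
    rcases g _ with _ | _ | _ <;> rcases h _ with _ | _ | _ <;> simp [joinLetter, leLetter]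

theorem cubeWord_injective : Function.Injective (cubeWord : SubHypercube n → Word) := by
  intro g h hgh
  exact (leWord_cubeWord.1 (hgh ▸ leWord_cubeWord.2 (.refl g))).antisymm
    (leWord_cubeWord.1 (hgh ▸ leWord_cubeWord.2 (.refl g)))

theorem leWord_pointCube {x y : Config n} :
    leWord (cubeWord (pointCube x)) (cubeWord (pointCube y)) = true ↔ x = y := by
  rw [leWord_cubeWord]
  refine ⟨fun h => ?_, fun h => h ▸ .refl _⟩
  funext i
  simpa [pointCube] using h i

theorem isBits_pointCube (x : Config n) : isBits (cubeWord (pointCube x)) = true := by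
  simp [isBits, cubeWord, pointCube, letterCode, List.all_eq_true]

theorem exists_cubeWord_eq {w : Word} (hw : .sep ∉ w) :
    ∃ h : SubHypercube w.length, w = cubeWord h := by
  refine ⟨fun i => match w[i] with
    | .bit b => some b
    | _ => none, ?_⟩
  apply List.ext_getElem
  · simp [cubeWord]
  · intro i h₁ h₂
    simp only [cubeWord, List.getElem_ofFn, Fin.getElem_fin]
    have : w[i] ≠ .sep := fun h => hw (h ▸ List.getElem_mem h₁)
    revert this
    rcases w[i] with _ | _ | _ <;> simp

theorem exists_pointCube_eq {w : Word} (hw : isBits w = true) (hn : w.length = n) :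
    ∃ x : Config n, cubeWord (pointCube x) = w := by
  subst hn
  rw [isBits, List.all_eq_true] at hw
  refine ⟨fun i => (letterCode w[i]).2, ?_⟩
  apply List.ext_getElem
  · simp [cubeWord]
  · intro i h₁ h₂
    have := hw w[i] (List.getElem_mem h₂)
    simp only [cubeWord, pointCube, List.getElem_ofFn, Fin.getElem_fin, Option.elim_some]
    revert this
    rcases w[i] with _ | _ | _ <;> simp [letterCode]

end Cubes

variable {n : ℕ}

/-! ### The smallest trap space containing a sub-hypercube. -/

section Closure

/-- Add the target of an edge to a sub-hypercube that contains its source. -/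
noncomputable def addTarget (c : SubHypercube n) (e : Config n × Config n) : SubHypercube n :=
  open Classical in if e.1 ∈ vertices c then cubeJoin c (pointCube e.2) else c

/-- Treat all edges of a list by `addTarget`, one after the other. -/
noncomputable def addTargets (es : List (Config n × Config n)) (c : SubHypercube n) :
    SubHypercube n :=
  es.foldl addTarget c

/-- The smallest sub-hypercube that contains `c` and is closed under the given edges. -/
noncomputable def trapClosure (es : List (Config n × Config n)) (c : SubHypercube n) :
    SubHypercube n :=
  (addTargets es)^[n] c

theorem le_addTarget (c : SubHypercube n) (e : Config n × Config n) : CubeLE c (addTarget c e) := by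
  rw [addTarget]
  split_ifs
  · exact cubeLE_join_left _ _
  · exact .refl _

theorem le_addTargets (es : List (Config n × Config n)) (c : SubHypercube n) :
    CubeLE c (addTargets es c) := by
  induction es generalizing c with
  | nil => exact .refl _
  | cons e es ih => exact (le_addTarget c e).trans (ih _)

/-- Each edge can only enlarge the cube, so a pass that ends where it began has changed nothing in
between. -/
theorem addTarget_eq_of_addTargets_eq {es : List (Config n × Config n)} {c : SubHypercube n}
    (h : addTargets es c = c) {e : Config n × Config n} (he : e ∈ es) : addTarget c e = c := by
  induction es with
  | nil => simp at he
  | cons e' es ih =>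
    have h' : addTargets es (addTarget c e') = c := h
    have h₁ : addTarget c e' = c := by
      refine CubeLE.antisymm ?_ (le_addTarget c e')
      have := le_addTargets es (addTarget c e')
      rwa [h'] at this
    rcases List.mem_cons.1 he with rfl | he
    · exact h₁
    · rw [h₁] at h'
      exact ih h' he

/-- The number of free entries of a sub-hypercube. -/
def freeCount (c : SubHypercube n) : ℕ := (Finset.univ.filter fun i => c i = none).card

theorem freeCount_le (c : SubHypercube n) : freeCount c ≤ n :=
  (Finset.card_filter_le _ _).trans (by simp)

theorem freeCount_lt {c d : SubHypercube n} (h : CubeLE c d) (hne : d ≠ c) :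
    freeCount c < freeCount d := by
  refine Finset.card_lt_card (Finset.ssubset_iff_of_subset ?_ |>.2 ?_)
  · intro i hi
    simp only [Finset.mem_filter, Finset.mem_univ, true_and] at hi ⊢
    rcases h i with h | h
    · exact h
    · rw [← h, hi]
  · obtain ⟨i, hi⟩ := Function.ne_iff.1 hne
    refine ⟨i, ?_⟩
    simp only [Finset.mem_filter, Finset.mem_univ, true_and]
    rcases h i with h | h
    · exact ⟨h, fun h' => hi (h.trans h'.symm)⟩
    · exact absurd h.symm hi

theorem iterate_stable {α : Type} {g : α → α} {μ : α → ℕ} (hμ : ∀ a, g a = a ∨ μ a < μ (g a))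
    (a : α) (k : ℕ) : g (g^[k] a) = g^[k] a ∨ k ≤ μ (g^[k] a) := by
  induction k with
  | zero => exact Or.inr (Nat.zero_le _)
  | succ k ih =>
    rw [Function.iterate_succ_apply']
    rcases ih with ih | ih
    · exact Or.inl (by rw [ih, ih])
    · rcases hμ (g^[k] a) with h | h
      · exact Or.inl (by rw [h, h])
      · exact Or.inr (by omega)

/-- A pass that changes the cube increases the number of free entries, which never exceeds `n`. If
the iteration has not become stationary, there are already `n` free entries and no further change is
possible. -/
theorem addTargets_trapClosure (es : List (Config n × Config n)) (c : SubHypercube n) :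
    addTargets es (trapClosure es c) = trapClosure es c := by
  have hμ : ∀ a, addTargets es a = a ∨ freeCount a < freeCount (addTargets es a) := by
    intro a
    by_cases h : addTargets es a = a
    · exact Or.inl h
    · exact Or.inr (freeCount_lt (le_addTargets es a) h)
  rcases iterate_stable hμ c n with h | h
  · exact h
  · rcases hμ (trapClosure es c) with h' | h'
    · exact h'
    · have := freeCount_le (addTargets es (trapClosure es c))
      rw [trapClosure] at h' this
      omega

theorem le_trapClosure (es : List (Config n × Config n)) (c : SubHypercube n) :
    CubeLE c (trapClosure es c) := by
  suffices h : ∀ k, CubeLE c ((addTargets es)^[k] c) from h n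
  intro k
  induction k with
  | zero => exact .refl _
  | succ k ih =>
    rw [Function.iterate_succ_apply']
    exact ih.trans (le_addTargets _ _)

variable {f : BN n} {es : List (Config n × Config n)}

theorem isTrapSpace_trapClosure (hes : IsEdgeList (functionalGraph f) es) (c : SubHypercube n) :
    IsTrapSpace f (trapClosure es c) := by
  intro x hx
  have he : (x, f x) ∈ es := (hes.2 x (f x)).2 rfl
  have h := addTarget_eq_of_addTargets_eq (addTargets_trapClosure es c) he
  rw [addTarget, if_pos hx] at h
  have h' := cubeLE_join_right (trapClosure es c) (pointCube (f x))
  rw [h] at h'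
  exact mem_vertices_iff.2 h'

theorem addTargets_le {k : SubHypercube n} (hk : ∀ e ∈ es, e.1 ∈ vertices k → e.2 ∈ vertices k)
    {c : SubHypercube n} (hc : CubeLE c k) : CubeLE (addTargets es c) k := by
  induction es generalizing c with
  | nil => exact hc
  | cons e es ih =>
    refine ih (fun e' he' => hk e' (List.mem_cons_of_mem _ he')) ?_
    rw [addTarget]
    split_ifs with h
    · exact cubeJoin_le hc (mem_vertices_iff.1 (hk e List.mem_cons_self (cubeLE_iff.1 hc h)))
    · exact hc

theorem trapClosure_le (hes : IsEdgeList (functionalGraph f) es) {c k : SubHypercube n}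
    (hk : IsTrapSpace f k) (hc : CubeLE c k) : CubeLE (trapClosure es c) k := by
  suffices h : ∀ m, CubeLE ((addTargets es)^[m] c) k from h n
  intro m
  induction m with
  | zero => exact hc
  | succ m ih =>
    rw [Function.iterate_succ_apply']
    refine addTargets_le (fun e he h => ?_) ih
    have : e.2 = f e.1 := (hes.2 e.1 e.2).1 he
    rw [this]
    exact hk _ h

theorem isTrapSpace_iff (hes : IsEdgeList (functionalGraph f) es) (h : SubHypercube n) :
    IsTrapSpace f h ↔ CubeLE (trapClosure es h) h := by
  refine ⟨fun H => trapClosure_le hes H (.refl h), fun H => ?_⟩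
  have := isTrapSpace_trapClosure hes h
  rwa [H.antisymm (le_trapClosure es h)] at this

/-- The closure of a vertex is a trap space inside `h`, hence equal to `h` by minimality.
Conversely, a trap space inside `h` has a vertex and contains its closure, which is `h`. That `h`
itself is a trap space comes for free, because cubes are nonempty. -/
theorem isMinTrapSpace_iff (hes : IsEdgeList (functionalGraph f) es) (h : SubHypercube n) :
    IsMinTrapSpace f h ↔ ∀ x ∈ vertices h, trapClosure es (pointCube x) = h := by
  constructor
  · rintro ⟨h₁, h₂⟩ x hx
    have hle := trapClosure_le hes h₁ (mem_vertices_iff.1 hx)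
    refine hle.antisymm (cubeLE_iff.2 ?_)
    by_contra hn
    exact h₂ ⟨_, isTrapSpace_trapClosure hes _, cubeLE_iff.1 hle, hn⟩
  · intro H
    constructor
    · obtain ⟨x, hx⟩ := vertices_nonempty h
      rw [← H x hx]
      exact isTrapSpace_trapClosure hes _
    · rintro ⟨k, hk, hkh, hhk⟩
      obtain ⟨x, hx⟩ := vertices_nonempty k
      refine hhk (cubeLE_iff.1 ?_)
      rw [← H x (hkh hx)]
      exact trapClosure_le hes hk (mem_vertices_iff.1 hx)

theorem inMinTrapSpace_iff (hes : IsEdgeList (functionalGraph f) es) (x : Config n) :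
    InMinTrapSpace f x ↔ IsMinTrapSpace f (trapClosure es (pointCube x)) := by
  constructor
  · rintro ⟨h, hh, hx⟩
    rwa [(isMinTrapSpace_iff hes h).1 hh x hx]
  · exact fun h => ⟨_, h, mem_vertices_iff.2 (le_trapClosure es _)⟩

end Closure

/-! ### Correctness of the procedures on encodings. -/

section Words

/-- An edge as a pair of words. -/
def edgeWord (e : Config n × Config n) : Word × Word :=
  (cubeWord (pointCube e.1), cubeWord (pointCube e.2))

theorem pass_cubeWord (es : List (Config n × Config n)) (c : SubHypercube n) :
    pass (es.map edgeWord) (cubeWord c) = cubeWord (addTargets es c) := by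
  induction es generalizing c with
  | nil => rfl
  | cons e es ih =>
    refine Eq.trans ?_ (ih (addTarget c e))
    rw [pass, List.map_cons, List.foldl_cons, pass]
    congr 1
    rw [addTarget, mem_vertices_iff]
    split_ifs with h₁ h₂ h₂
    · exact joinWord_cubeWord _ _
    · exact absurd (leWord_cubeWord.1 h₁) h₂
    · exact absurd (leWord_cubeWord.2 h₂) h₁
    · rfl

theorem closureWord_cubeWord (es : List (Config n × Config n)) (c : SubHypercube n) :
    closureWord (es.map edgeWord) (cubeWord c) = cubeWord (trapClosure es c) := by
  rw [closureWord, List.foldl_const, length_cubeWord, trapClosure]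
  suffices h : ∀ k, (pass (es.map edgeWord))^[k] (cubeWord c) =
      cubeWord ((addTargets es)^[k] c) from h n
  intro k
  induction k with
  | zero => rfl
  | succ k ih => rw [Function.iterate_succ_apply', Function.iterate_succ_apply', ih, pass_cubeWord]

variable {f : BN n} {es : List (Config n × Config n)}

theorem checkTrap_iff (hes : IsEdgeList (functionalGraph f) es) (h : SubHypercube n) :
    checkTrap (cubeWord h, es.map edgeWord) = true ↔ IsTrapSpace f h := by
  rw [isTrapSpace_iff hes, checkTrap, closureWord_cubeWord, leWord_cubeWord]

theorem checkMinTrap_iff (hes : IsEdgeList (functionalGraph f) es) (h : SubHypercube n) :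
    checkMinTrap (cubeWord h, es.map edgeWord) = true ↔ IsMinTrapSpace f h := by
  rw [isMinTrapSpace_iff hes, checkMinTrap, List.all_eq_true]
  simp only [List.forall_mem_map, edgeWord, closureWord_cubeWord, Bool.or_eq_true,
    Bool.and_eq_true, Bool.not_eq_true', Bool.eq_false_iff, ne_eq, leWord_cubeWord]
  constructor
  · intro H x hx
    rcases H (x, f x) ((hes.2 _ _).2 rfl) with h' | h'
    · exact absurd (mem_vertices_iff.1 hx) h'
    · exact h'.1.antisymm h'.2
  · intro H e _
    by_cases he : CubeLE (pointCube e.1) h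
    · rw [H e.1 (mem_vertices_iff.2 he)]
      exact Or.inr ⟨.refl _, .refl _⟩
    · exact Or.inl he

theorem checkInMinTrap_iff (hes : IsEdgeList (functionalGraph f) es) (x : Config n) :
    checkInMinTrap (cubeWord (pointCube x), es.map edgeWord) = true ↔ InMinTrapSpace f x := by
  rw [inMinTrapSpace_iff hes, checkInMinTrap, isBits_pointCube, Bool.true_and,
    closureWord_cubeWord, checkMinTrap_iff hes]

/-- This tests the number of edges without computing `2 ^ h.length`, which on a malformed input may
be exponential in its length. -/
theorem halvings_iff (h : Word) (m : ℕ) :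
    ((halvings h m).1 = true ∧ (halvings h m).2 = 1) ↔ m = 2 ^ h.length := by
  suffices H : ∀ (b : Bool) (m : ℕ),
      ((h.foldl (fun s _ => (s.1 && !decide (s.2 % 2 = 1), s.2 / 2)) (b, m)).1 = true ∧
      (h.foldl (fun s _ => (s.1 && !decide (s.2 % 2 = 1), s.2 / 2)) (b, m)).2 = 1) ↔
      (b = true ∧ m = 2 ^ h.length) by
    simpa [halvings] using H true m
  induction h with
  | nil => simp
  | cons a h ih =>
    intro b m
    rw [List.foldl_cons, ih, List.length_cons, pow_succ]
    simp only [Bool.and_eq_true, Bool.not_eq_true', decide_eq_false_iff_not]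
    constructor
    · rintro ⟨⟨hb, h₁⟩, h₂⟩
      exact ⟨hb, by omega⟩
    · rintro ⟨hb, rfl⟩
      exact ⟨⟨hb, by omega⟩, by omega⟩

theorem distinctSources_iff (es : List (Config n × Config n)) :
    distinctSources (es.map edgeWord) = true ↔ (es.map Prod.fst).Nodup := by
  suffices h : ((es.map edgeWord).foldr
      (fun e s => (s.1 && !s.2.any fun x => leWord e.1 x, e.1 :: s.2)) (true, ([] : List Word))).2 =
        (es.map Prod.fst).map (fun x => cubeWord (pointCube x)) ∧
      (((es.map edgeWord).foldr
      (fun e s => (s.1 && !s.2.any fun x => leWord e.1 x, e.1 :: s.2)) (true, ([] : List Word))).1 =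
        true ↔ (es.map Prod.fst).Nodup) from h.2
  induction es with
  | nil => simp
  | cons e es ih =>
    simp only [List.map_cons, List.foldr_cons, List.nodup_cons, Bool.and_eq_true, ih.1, ih.2]
    refine ⟨rfl, ?_⟩
    rw [and_comm]
    refine and_congr_left fun _ => ?_
    rw [Bool.not_eq_true', Bool.eq_false_iff, ne_eq, List.any_eq_true]
    simp only [List.mem_map, edgeWord]
    refine not_congr ⟨?_, ?_⟩
    · rintro ⟨_, ⟨x, hx, rfl⟩, h⟩
      rw [leWord_pointCube] at h
      exact h ▸ hx
    · exact fun h => ⟨_, ⟨_, h, rfl⟩, leWord_pointCube.2 rfl⟩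

theorem isGraph_map_edgeWord (hes : IsEdgeList (functionalGraph f) es) (h : SubHypercube n) :
    isGraph (cubeWord h) (es.map edgeWord) = true := by
  have hfst : ∀ e ∈ es, e.2 = f e.1 := fun e he => (hes.2 e.1 e.2).1 he
  have hnodup : (es.map Prod.fst).Nodup := by
    refine (List.nodup_map_iff_inj_on hes.1).2 fun a ha b hb hab => Prod.ext hab ?_
    rw [hfst a ha, hfst b hb, hab]
  have hlen : es.length = 2 ^ n := by
    have h₁ : (es.map Prod.fst).toFinset = Finset.univ := by
      ext x
      simp only [List.mem_toFinset, List.mem_map, Finset.mem_univ, iff_true]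
      exact ⟨(x, f x), (hes.2 _ _).2 rfl, rfl⟩
    have h₂ := List.toFinset_card_of_nodup hnodup
    rw [h₁] at h₂
    simpa using h₂.symm
  have h₃ := (halvings_iff (cubeWord h) (es.map edgeWord).length).2
    (by rw [List.length_map, length_cubeWord, hlen])
  simp only [isGraph, Bool.and_eq_true, List.all_eq_true, List.forall_mem_map,
    decide_eq_true_eq]
  exact ⟨fun e _ => ⟨⟨isBits_pointCube _, isBits_pointCube _⟩, by
    simp [edgeWord, length_cubeWord], by simp [edgeWord, length_cubeWord]⟩,
    (distinctSources_iff es).2 hnodup, h₃⟩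

/-- Having `2 ^ n` distinct sources among `2 ^ n` configurations, the list leaves each configuration
by exactly one edge, which defines `f`. -/
theorem exists_of_isGraph {h : SubHypercube n} {ws : List (Word × Word)}
    (hg : isGraph (cubeWord h) ws = true) :
    ∃ (f : BN n) (es : List (Config n × Config n)),
      IsEdgeList (functionalGraph f) es ∧ ws = es.map edgeWord := by
  simp only [isGraph, Bool.and_eq_true, List.all_eq_true, decide_eq_true_eq, length_cubeWord] at hg
  obtain ⟨h₁, h₂, h₃⟩ := hg
  have hws : ws ∈ Set.range (List.map (edgeWord (n := n))) := by
    rw [Set.range_list_map]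
    intro e he
    obtain ⟨⟨hb₁, hb₂⟩, hl₁, hl₂⟩ := h₁ e he
    obtain ⟨x, hx⟩ := exists_pointCube_eq hb₁ hl₁
    obtain ⟨y, hy⟩ := exists_pointCube_eq hb₂ hl₂
    exact ⟨(x, y), Prod.ext hx hy⟩
  obtain ⟨es, rfl⟩ := hws
  rw [distinctSources_iff] at h₂
  rw [halvings_iff, List.length_map, length_cubeWord] at h₃
  have hall : ∀ x, ∃ y, (x, y) ∈ es := by
    have hu : (es.map Prod.fst).toFinset = Finset.univ := by
      rw [← Finset.card_eq_iff_eq_univ, List.toFinset_card_of_nodup h₂]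
      simpa using h₃
    intro x
    have hx := Finset.mem_univ x
    rw [← hu, List.mem_toFinset, List.mem_map] at hx
    obtain ⟨e, he, rfl⟩ := hx
    exact ⟨e.2, he⟩
  choose f hf using hall
  refine ⟨f, es, ⟨List.Nodup.of_map _ h₂, fun x y => ⟨fun hxy => ?_, ?_⟩⟩, rfl⟩
  · exact congrArg Prod.snd (List.inj_on_of_nodup_map h₂ hxy (hf x) rfl)
  · rintro rfl
    exact hf x

theorem encodeCube_append_encodeEdges (h : SubHypercube n) (es : List (Config n × Config n)) :
    encodeCube h ++ encodeEdges es = joinSep (cubeWord h :: endpoints (es.map edgeWord)) := by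
  have hes : encodeEdges es = joinSep (endpoints (es.map edgeWord)) := by
    induction es with
    | nil => rfl
    | cons e es ih =>
      have h₁ : encodeEdges (e :: es) = encodeConfig e.1 ++ (encodeConfig e.2 ++ encodeEdges es) := by
        simp [encodeEdges]
      rw [h₁, ih]
      rfl
  rw [hes]
  rfl

theorem decideInstance_eq_true_iff {check : Word × List (Word × Word) → Bool}
    {Q : ∀ {n : ℕ}, BN n → SubHypercube n → Prop}
    (hQ : ∀ {n : ℕ} {f : BN n} {es : List (Config n × Config n)},
      IsEdgeList (functionalGraph f) es → ∀ h : SubHypercube n,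
        check (cubeWord h, es.map edgeWord) = true ↔ Q f h) (w : Word) :
    decideInstance check w = true ↔
      ∃ (n : ℕ) (f : BN n) (h : SubHypercube n) (es : List (Config n × Config n)),
        IsEdgeList (functionalGraph f) es ∧ w = encodeCube h ++ encodeEdges es ∧ Q f h := by
  rw [decideInstance_iff]
  constructor
  · rintro ⟨u, ws, hu, -, rfl, hg, hc⟩
    obtain ⟨h, hh⟩ := exists_cubeWord_eq hu
    -- The type of `h` mentions `u`; abstracting the length makes `u` replaceable by `cubeWord h`.
    generalize u.length = n at h hh
    subst hh
    obtain ⟨f, es, hes, rfl⟩ := exists_of_isGraph hg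
    exact ⟨n, f, h, es, hes, (encodeCube_append_encodeEdges h es).symm, (hQ hes h).1 hc⟩
  · rintro ⟨n, f, h, es, hes, rfl, hq⟩
    refine ⟨cubeWord h, es.map edgeWord, sep_notMem_cubeWord h, ?_,
      encodeCube_append_encodeEdges h es, isGraph_map_edgeWord hes h, (hQ hes h).2 hq⟩
    simp only [List.forall_mem_map]
    exact fun e _ => ⟨sep_notMem_cubeWord _, sep_notMem_cubeWord _⟩

theorem inP_of_decides {L : Language Letter} {check : Word × List (Word × Word) → Bool}
    (hc : PolyTime check) (h : ∀ w, decideInstance check w = true ↔ w ∈ L) : InP L := by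
  classical
  have hf : decideInstance check = fun w => decide (w ∈ L) := by
    funext w
    rw [Bool.eq_iff_iff, h w, decide_eq_true_iff]
  have := (polyTime_decideInstance hc).computable
  rw [hf] at this
  unfold InP
  convert this

end Words

end BooleanNetwork

/-! ### The three problems. -/

open BooleanNetwork in
theorem mainTheorem7 :
    BooleanNetwork.InP BooleanNetwork.TRAPSPACE ∧
      BooleanNetwork.InP BooleanNetwork.MINTRAP ∧
      BooleanNetwork.InP BooleanNetwork.INMINTRAP := by
  refine ⟨inP_of_decides polyTime_checkTrap (decideInstance_eq_true_iff checkTrap_iff),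
    inP_of_decides polyTime_checkMinTrap (decideInstance_eq_true_iff checkMinTrap_iff),
    inP_of_decides polyTime_checkInMinTrap fun w => ?_⟩
  -- A configuration is encoded like a cube without free entries, so IN-MINTRAP becomes a problem
  -- about cubes; `isBits` in the check rejects those with free entries.
  have hQ : ∀ {n : ℕ} {f : BN n} {es : List (Config n × Config n)},
      IsEdgeList (functionalGraph f) es → ∀ h : SubHypercube n,
        checkInMinTrap (cubeWord h, es.map edgeWord) = true ↔
          ∃ x, h = pointCube x ∧ InMinTrapSpace f x := by
    intro n f es hes h
    constructor
    · intro hc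
      have hb := hc
      rw [checkInMinTrap, Bool.and_eq_true] at hb
      obtain ⟨x, hx⟩ := exists_pointCube_eq hb.1 (length_cubeWord h)
      obtain rfl := cubeWord_injective hx
      exact ⟨x, rfl, (checkInMinTrap_iff hes x).1 hc⟩
    · rintro ⟨x, rfl, hx⟩
      exact (checkInMinTrap_iff hes x).2 hx
  rw [decideInstance_eq_true_iff hQ]
  constructor
  · rintro ⟨n, f, _, es, hes, rfl, x, rfl, hx⟩
    exact ⟨n, f, x, es, hes, rfl, hx⟩
  · rintro ⟨n, f, x, es, hes, rfl, hx⟩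
    exact ⟨n, f, pointCube x, es, hes, rfl, x, rfl, hx⟩
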